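/- Let $\pi:Q\to\mathbb R$ be a smooth fibred manifold (a smooth surjective submersion, for instance a smooth fibre bundle) of dimension $m+1$, with fibred coordinates $(t,q^i)$, $i=1,\dots,m$, where $t$ is the standard coordinate of $\mathbb R$. Let $J^1Q$ be its first order jet manifold, with coordinates $(t,q^i,q^i_t)$; let $V^*Q$ be its vertical cotangent bundle, with coordinates $(t,q^i,p_i)$; write $\partial_i=\partial/\partial q^i$, $\partial_i^t=\partial/\partial q^i_t$, $\partial^i=\partial/\partial p_i$. Let $L=\mathcal L\,dt$, with $\mathcal L:J^1Q\to\mathbb R$ smooth, be a first order Lagrangian. Put $\pi_i=\partial_i^t\mathcal L$; let $\widehat L:J^1Q\to V^*Q$, $p_i\circ\widehat L=\pi_i$, be the Legendre map over $Q$, and $N_L=\widehat L(J^1Q)$. Assume that $L$ is almost regular: $N_L$ is a closed imbedded subbundle of $V^*Q\to Q$, and $\widehat L:J^1Q\to N_L$ is a surjective submersion with connected fibres. Let $\overline s$ be a smooth section of $J^1Q\to\mathbb R$ over an open set $U\subseteq\mathbb R$ (for instance $U=\mathbb R$), and let $s$ be its projection onto $Q$. Assume that $\overline s$ is a solution of the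 Cartan equation, that is, along $\overline s$, in all fibred coordinates and for all $i$, $$\partial_i^t\pi_j\,\bigl(\tfrac{d q^j}{dt}-q^j_t\bigr)=0,\qquad \partial_i\mathcal L-\tfrac{d}{dt}\pi_i+\partial_i\pi_j\,\bigl(\tfrac{d q^j}{dt}-q^j_t\bigr)=0 .$$ Let $H=p_i\,dq^i-\mathcal H\,dt$ be a Hamiltonian form on $V^*Q$, that is, the pull-back of the Liouville form $p_0\,dt+p_i\,dq^i$ of $T^*Q$ by a smooth global section of $T^*Q\to V^*Q$ (so $\mathcal H=-p_0$ on this section). Let $\widehat H:V^*Q\to J^1Q$, $q^i_t\circ\widehat H=\partial^i\mathcal H$, be its Hamiltonian map over $Q$. Assume that $H$ is weakly associated with $L$, that is, at every point $(t,q,p)$ of $N_L$, $$p_i\,\partial^i\mathcal H-\mathcal H=\mathcal L(t,q^j,\partial^j\mathcal H),$$ and that $$\widehat H\circ\widehat L\circ\overline s=J^1s\quad\text{on }U .$$ Then $r=\widehat L\circ\overline s$ is a smooth section of $V^*Q\to\mathbb R$ over $U$ and is a solution of the Hamilton equation for $H$: along $r$, in all fibred coordinates, $$\frac{dq^k}{dt}=\partial^k\mathcal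 H,\qquad \frac{dp_k}{dt}=-\partial_k\mathcal H .$$ -/

import Mathlib

open Set Filter Topology
open scoped Manifold ContDiff

namespace TimeMechanics

/-- Coordinate space for the bundle coordinates `(t, q)`, `q = (q^1, …, q^m)`. -/
abbrev Cfg (m : ℕ) : Type := ℝ × (Fin m → ℝ)

/-- Coordinate space for `(t, q, q_t)` on the velocity space and for `(t, q, p)` on the
phase space. -/
abbrev Cfg₁ (m : ℕ) : Type := Cfg m × (Fin m → ℝ)

section Bundles

variable {m : ℕ} {Q : Type*} [TopologicalSpace Q] [ChartedSpace (Cfg m) Q]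

/-- The one-form `dt` on `Q` (the differential of `π : Q → ℝ`) at the point `x`. The tangent space
at `x` is, in Mathlib, a copy of the model space `Cfg m`. -/
noncomputable def dt (π : Q → ℝ) (x : Q) : Cfg m →L[ℝ] ℝ :=
  mfderiv 𝓘(ℝ, Cfg m) 𝓘(ℝ, ℝ) π x

/-- `π : Q → ℝ` is a smooth fibred manifold, i.e. a smooth surjective submersion. -/
structure IsFibredManifold (π : Q → ℝ) : Prop where
  smooth : ContMDiff 𝓘(ℝ, Cfg m) 𝓘(ℝ, ℝ) ∞ π
  surjective : Function.Surjective π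
  submersion : ∀ x, Function.Surjective (dt (m := m) π x)

/-- `φ = (t, q^1, …, q^m)` is a fibred (bundle) coordinate chart of `Q` over the time axis. -/
def IsFibredChart (π : Q → ℝ) (φ : OpenPartialHomeomorph Q (Cfg m)) : Prop :=
  φ ∈ IsManifold.maximalAtlas 𝓘(ℝ, Cfg m) ∞ Q ∧ ∀ x ∈ φ.source, (φ x).1 = π x

/-- The vertical tangent space `V_x Q = ker dt`. -/
noncomputable def Vert (π : Q → ℝ) (x : Q) : Submodule ℝ (Cfg m) :=
  LinearMap.ker (dt (m := m) π x : Cfg m →ₗ[ℝ] ℝ)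

/-- The velocity space `J¹Q`, canonically imbedded in `TQ` as the set of the tangent vectors `v`
with `dt(v) = 1`; the jet at `t` of a section `s` is the velocity vector of `s` at `t`. -/
def Jet (m : ℕ) {Q : Type*} [TopologicalSpace Q] [ChartedSpace (Cfg m) Q] (π : Q → ℝ) : Type _ :=
  {v : TangentBundle 𝓘(ℝ, Cfg m) Q // dt (m := m) π v.proj v.snd = 1}

instance [IsManifold 𝓘(ℝ, Cfg m) ∞ Q] (π : Q → ℝ) : TopologicalSpace (Jet m π) :=
  inferInstanceAs (TopologicalSpace {v : TangentBundle 𝓘(ℝ, Cfg m) Q //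
    dt (m := m) π v.proj v.snd = 1})

/-- The projection `J¹Q → Q`. -/
def Jet.pt {π : Q → ℝ} (z : Jet m π) : Q := z.1.proj

/-- The tangent vector underlying a jet. -/
def Jet.vel {π : Q → ℝ} (z : Jet m π) : Cfg m := z.1.snd

theorem Jet.dt_vel {π : Q → ℝ} (z : Jet m π) : dt π z.pt z.vel = 1 := z.2

/-- The jet at `x` with the velocity vector `v`. -/
def Jet.mk {π : Q → ℝ} (x : Q) (v : Cfg m) (h : dt π x v = 1) : Jet m π := ⟨⟨x, v⟩, h⟩

/-- Jets over a fixed point form an affine space modelled on the vertical tangent space. -/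
noncomputable def Jet.addVert {π : Q → ℝ} (z : Jet m π) (w : Vert (m := m) π z.pt) : Jet m π :=
  Jet.mk z.pt (z.vel + w) (by
    have h : dt π z.pt (w : Cfg m) = 0 := w.2
    rw [map_add, z.dt_vel, h, add_zero])

/-- The phase space: the vertical cotangent bundle `V*Q`, whose fibre at `x` is the dual of
`V_x Q`. -/
structure VCot (m : ℕ) {Q : Type*} [TopologicalSpace Q] [ChartedSpace (Cfg m) Q]
    (π : Q → ℝ) where
  /-- the projection `π_Π : V*Q → Q` -/
  pt : Q
  /-- the covector -/
  mom : Vert (m := m) π pt →L[ℝ] ℝ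

/-! ### Coordinates -/

/-- The components in the model space of `T_xQ` of the tangent vector `v^t ∂_t + v^i ∂_i` of the
chart `φ` at the point `x` with coordinates `y`. -/
noncomputable def chartVec (φ : OpenPartialHomeomorph Q (Cfg m)) (y : Cfg m) : Cfg m →L[ℝ] Cfg m :=
  mfderiv 𝓘(ℝ, Cfg m) 𝓘(ℝ, Cfg m) φ.symm y

/-- Components `(v^t, v^i)` in the chart `φ` of a tangent vector `v` at `x`. -/
noncomputable def chartComp (φ : OpenPartialHomeomorph Q (Cfg m)) (x : Q) : Cfg m →L[ℝ] Cfg m :=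
  mfderiv 𝓘(ℝ, Cfg m) 𝓘(ℝ, Cfg m) φ x

/-- In a fibred chart, `dt (v^t ∂_t + v^i ∂_i) = v^t`. In particular `∂_t + v^i ∂_i` is a jet and
`∂_i` is vertical. -/
theorem dt_chartVec {π : Q → ℝ}
    {φ : OpenPartialHomeomorph Q (Cfg m)} (hφ : IsFibredChart π φ) {y : Cfg m}
    (hy : y ∈ φ.target) (v : Cfg m) :
    dt π (φ.symm y) (chartVec φ y v) = v.1 := by
  have hx : φ.symm y ∈ φ.source := φ.map_target hy
  have hs : MDifferentiableAt 𝓘(ℝ, Cfg m) 𝓘(ℝ, Cfg m) φ.symm y :=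
    ((contMDiffOn_symm_of_mem_maximalAtlas hφ.1).contMDiffAt
      (φ.open_target.mem_nhds hy)).mdifferentiableAt (by simp)
  have hf : MDifferentiableAt 𝓘(ℝ, Cfg m) 𝓘(ℝ, Cfg m) φ (φ.symm y) :=
    ((contMDiffOn_of_mem_maximalAtlas hφ.1).contMDiffAt
      (φ.open_source.mem_nhds hx)).mdifferentiableAt (by simp)
  have hfst : MDifferentiableAt 𝓘(ℝ, Cfg m) 𝓘(ℝ, ℝ) (fun c : Cfg m => c.1) (φ (φ.symm y)) :=
    differentiableAt_fst.mdifferentiableAt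
  have hπ : MDifferentiableAt 𝓘(ℝ, Cfg m) 𝓘(ℝ, ℝ) π (φ.symm y) := by
    refine (hfst.comp (φ.symm y) hf).congr_of_eventuallyEq ?_
    filter_upwards [φ.open_source.mem_nhds hx] with x h using (hφ.2 x h).symm
  have hcomp : (π ∘ φ.symm) =ᶠ[𝓝 y] fun c : Cfg m => c.1 := by
    filter_upwards [φ.open_target.mem_nhds hy] with c hc
    show π (φ.symm c) = c.1
    rw [← hφ.2 _ (φ.map_target hc), φ.right_inv hc]
  have h1 := mfderiv_comp y hπ hs
  rw [hcomp.mfderiv_eq] at h1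
  have h2 := congrArg (fun A : Cfg m →L[ℝ] ℝ => A v) h1
  have h3 : mfderiv 𝓘(ℝ, Cfg m) 𝓘(ℝ, ℝ) (fun c : Cfg m => c.1) y = fderiv ℝ (fun c : Cfg m => c.1) y :=
    mfderiv_eq_fderiv
  rw [h3] at h2
  have h4 : fderiv ℝ (fun c : Cfg m => c.1) y = ContinuousLinearMap.fst ℝ ℝ (Fin m → ℝ) := fderiv_fst
  rw [h4] at h2
  exact h2.symm

/-- The coordinates `(t, q^i, q^i_t)` of a jet. -/
noncomputable def jetCoord {π : Q → ℝ} (φ : OpenPartialHomeomorph Q (Cfg m)) (z : Jet m π) :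
    Cfg₁ m :=
  (φ z.pt, (chartComp φ z.pt z.vel).2)

open Classical in
/-- The value of `p ∈ V*Q` on a vertical vector at its base point (and `0` on other vectors). -/
noncomputable def VCot.eval {π : Q → ℝ} (p : VCot m π) (v : Cfg m) : ℝ :=
  if h : v ∈ Vert (m := m) π p.pt then p.mom ⟨v, h⟩ else 0

/-- The coordinates `(t, q^i, p_i)` on `V*Q`, with `p_i` the value on the vertical vector `∂_i`. -/
noncomputable def momCoord {π : Q → ℝ} (φ : OpenPartialHomeomorph Q (Cfg m)) (p : VCot m π) :
    Cfg₁ m :=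
  (φ p.pt, fun i => p.eval (chartVec φ (φ p.pt) (0, Pi.single i 1)))

/-- The point of `V*Q` with the coordinates `c = (t, q^i, p_i)`: the covector `p_i dq^i`
restricted to vertical vectors. -/
noncomputable def momPoint (π : Q → ℝ) (φ : OpenPartialHomeomorph Q (Cfg m)) (c : Cfg₁ m) :
    VCot m π where
  pt := φ.symm c.1
  mom := ((∑ i, c.2 i • ContinuousLinearMap.proj (R := ℝ) (φ := fun _ : Fin m => ℝ) i).comp
    ((ContinuousLinearMap.snd ℝ ℝ (Fin m → ℝ)).comp (chartComp φ (φ.symm c.1)))).comp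
      (Vert (m := m) π (φ.symm c.1)).subtypeL

/-- The partial derivative `∂_i = ∂/∂q^i` of a function of `(t, q, q_t)` or of `(t, q, p)`. -/
noncomputable def dq {m : ℕ} (i : Fin m) (f : Cfg₁ m → ℝ) (c : Cfg₁ m) : ℝ :=
  fderiv ℝ f c ((0, Pi.single i 1), 0)

/-- The partial derivative with respect to the `i`-th fibre coordinate: `∂_i^t = ∂/∂q^i_t` for a
function of `(t, q, q_t)`, and `∂^i = ∂/∂p_i` for a function of `(t, q, p)`. -/
noncomputable def dv {m : ℕ} (i : Fin m) (f : Cfg₁ m → ℝ) (c : Cfg₁ m) : ℝ :=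
  fderiv ℝ f c (0, Pi.single i 1)

/-! ### Lagrangians -/

open Classical in
/-- The coordinate expression `𝓛(t, q, q_t)` in the chart `φ` of a function on `J¹Q`. (In a fibred
chart `∂_t + q^i_t ∂_i` is a jet, so that the value `0` is never used over the chart.) -/
noncomputable def localLagrangian {π : Q → ℝ} (L : Jet m π → ℝ)
    (φ : OpenPartialHomeomorph Q (Cfg m)) (c : Cfg₁ m) : ℝ :=
  if h : dt π (φ.symm c.1) (chartVec φ c.1 (1, c.2)) = 1 then
    L (Jet.mk (φ.symm c.1) (chartVec φ c.1 (1, c.2)) h) else 0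

/-- A first order Lagrangian `L = 𝓛 dt`, given by a smooth function `𝓛` on `J¹Q`. -/
structure Lagrangian (m : ℕ) {Q : Type*} [TopologicalSpace Q] [ChartedSpace (Cfg m) Q]
    (π : Q → ℝ) where
  /-- the function `𝓛` -/
  toFun : Jet m π → ℝ
  smooth : ∀ φ : OpenPartialHomeomorph Q (Cfg m), IsFibredChart π φ →
    ContDiffOn ℝ ∞ (localLagrangian toFun φ) (φ.target ×ˢ univ)

variable {π : Q → ℝ}

/-- The coordinate expression of a Lagrangian. -/
noncomputable def Lagrangian.loc (L : Lagrangian m π) (φ : OpenPartialHomeomorph Q (Cfg m)) :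
    Cfg₁ m → ℝ :=
  localLagrangian L.toFun φ

/-- The Legendre map `L̂ : J¹Q → V*Q`, the derivative of `𝓛` along the fibres of `J¹Q → Q`; in
coordinates `p_i ∘ L̂ = ∂_i^t 𝓛`. -/
noncomputable def Lagrangian.legendre (L : Lagrangian m π) (z : Jet m π) : VCot m π where
  pt := z.pt
  mom := fderiv ℝ (fun w : Vert (m := m) π z.pt => L.toFun (z.addVert w)) 0

/-- The Lagrangian constraint space `N_L = L̂(J¹Q)`. -/
def Lagrangian.constraintSpace (L : Lagrangian m π) : Set (VCot m π) := range L.legendre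

/-- The part over the chart `φ`, written in coordinates, of a subset of `V*Q`. -/
def inCoord (φ : OpenPartialHomeomorph Q (Cfg m)) (N : Set (VCot m π)) : Set (Cfg₁ m) :=
  {c | c.1 ∈ φ.target ∧ momPoint π φ c ∈ N}

/-- `N` is closed in `V*Q`: it is closed in every fibred coordinate chart of `V*Q`. -/
def IsClosedInPhaseSpace (N : Set (VCot m π)) : Prop :=
  ∀ φ : OpenPartialHomeomorph Q (Cfg m), IsFibredChart π φ →
    ∃ C : Set (Cfg₁ m), IsClosed C ∧ inCoord φ N = C ∩ (φ.target ×ˢ univ)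

/-- `N` is an imbedded subbundle of `V*Q → Q`: over a neighbourhood `U` of any point of `Q` (the
domain of a chart) it is the image of a smooth imbedding `(y, f) ↦ (y, P(y, f))` over `U` of
`U × F` in `V*U`, where the typical fibre `F` is a smooth manifold. Thus `N` is an imbedded
submanifold and `N → Q` is a locally trivial smooth bundle. -/
def IsImbeddedSubbundle (N : Set (VCot m π)) : Prop :=
  ∀ x : Q, ∃ φ : OpenPartialHomeomorph Q (Cfg m), IsFibredChart π φ ∧ x ∈ φ.source ∧
    ∃ (k : ℕ) (F : Type) (_ : TopologicalSpace F) (_ : ChartedSpace (EuclideanSpace ℝ (Fin k)) F)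
      (_ : IsManifold 𝓘(ℝ, EuclideanSpace ℝ (Fin k)) ∞ F) (P : Cfg m × F → (Fin m → ℝ)),
      ContMDiffOn (𝓘(ℝ, Cfg m).prod 𝓘(ℝ, EuclideanSpace ℝ (Fin k))) 𝓘(ℝ, Fin m → ℝ) ∞ P
        (φ.target ×ˢ univ) ∧
      (∀ y ∈ φ.target, ∀ f : F, Function.Injective
        (mfderiv 𝓘(ℝ, EuclideanSpace ℝ (Fin k)) 𝓘(ℝ, Fin m → ℝ) (fun g : F => P (y, g)) f)) ∧
      IsEmbedding (fun a : φ.target × F => (((a.1 : Cfg m), P ((a.1 : Cfg m), a.2)) : Cfg₁ m)) ∧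
      range (fun a : φ.target × F => (((a.1 : Cfg m), P ((a.1 : Cfg m), a.2)) : Cfg₁ m)) =
        inCoord φ N

/-- The coordinate expression `(t, q, q_t) ↦ (t, q, ∂_i^t 𝓛)` of the Legendre map. -/
noncomputable def Lagrangian.legendreLoc (L : Lagrangian m π)
    (φ : OpenPartialHomeomorph Q (Cfg m)) (c : Cfg₁ m) : Cfg₁ m :=
  (c.1, fun i => dv i (L.loc φ) c)

/-- The Legendre map is a submersion of `J¹Q` onto `N_L` (for `N_L` an imbedded submanifold): every
vector tangent to `N_L` at `L̂(z)`, i.e. the velocity at `0` of a smooth curve lying in `N_L`, is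
in the image of the tangent map of `L̂` at `z`. -/
def Lagrangian.LegendreIsSubmersion (L : Lagrangian m π) : Prop :=
  ∀ φ : OpenPartialHomeomorph Q (Cfg m), IsFibredChart π φ → ∀ c : Cfg₁ m, c.1 ∈ φ.target →
    ∀ γ : ℝ → Cfg₁ m, ContDiffAt ℝ ∞ γ 0 → γ 0 = L.legendreLoc φ c →
      (∀ᶠ τ in 𝓝 (0 : ℝ), γ τ ∈ inCoord φ L.constraintSpace) →
        deriv γ 0 ∈ range (fderiv ℝ (L.legendreLoc φ) c)

/-- Almost regular Lagrangians: `N_L` is a closed imbedded subbundle of `V*Q → Q`, and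
`L̂ : J¹Q → N_L` is a fibred manifold (a surjective submersion) with connected fibres. -/
structure Lagrangian.IsAlmostRegular [IsManifold 𝓘(ℝ, Cfg m) ∞ Q] (L : Lagrangian m π) : Prop where
  closed : IsClosedInPhaseSpace L.constraintSpace
  subbundle : IsImbeddedSubbundle L.constraintSpace
  submersion : L.LegendreIsSubmersion
  connected : ∀ p ∈ L.constraintSpace, IsConnected {z : Jet m π | L.legendre z = p}

/-- `sbar` is a smooth section of `J¹Q → ℝ` over the set `U` of instants. -/
def IsJetSectionOn [IsManifold 𝓘(ℝ, Cfg m) ∞ Q] (U : Set ℝ) (sbar : ℝ → Jet m π) : Prop :=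
  ContMDiffOn 𝓘(ℝ, ℝ) (𝓘(ℝ, Cfg m).tangent) ∞
    (fun t => ((sbar t).1 : TangentBundle 𝓘(ℝ, Cfg m) Q)) U ∧
  ∀ t ∈ U, π (sbar t).pt = t

/-- The Cartan equation
`∂_i^t π_j (q^j_(t) - q^j_t) = 0`,
`∂_i 𝓛 - d̂_t π_i + ∂_i π_j (q^j_(t) - q^j_t) = 0`, with `π_i = ∂_i^t 𝓛`,
for a section `sbar` of `J¹Q → ℝ` over `U`. Along the section, `q^j_(t)` is the time derivative of
the coordinate `q^j` and `d̂_t` is the time derivative. -/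
def Lagrangian.SolvesCartan (L : Lagrangian m π) (U : Set ℝ) (sbar : ℝ → Jet m π) : Prop :=
  ∀ φ : OpenPartialHomeomorph Q (Cfg m), IsFibredChart π φ →
    ∀ t ∈ U, (sbar t).pt ∈ φ.source → ∀ i : Fin m,
      (∑ j, dv i (dv j (L.loc φ)) (jetCoord φ (sbar t)) *
        (deriv (fun τ => (jetCoord φ (sbar τ)).1.2 j) t - (jetCoord φ (sbar t)).2 j) = 0) ∧
      (dq i (L.loc φ) (jetCoord φ (sbar t))
        - deriv (fun τ => dv i (L.loc φ) (jetCoord φ (sbar τ))) t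
        + ∑ j, dq i (dv j (L.loc φ)) (jetCoord φ (sbar t)) *
          (deriv (fun τ => (jetCoord φ (sbar τ)).1.2 j) t - (jetCoord φ (sbar t)).2 j) = 0)

/-! ### Hamiltonian forms -/

/-- The coordinate expression `𝓗(t, q, p)` of a map `h` from `V*Q` to covectors on `Q`:
`𝓗 = -p_0 ∘ h`, where `p_0` is the value of a covector on `∂_t`. -/
noncomputable def localHamiltonian (h : VCot m π → (Cfg m →L[ℝ] ℝ))
    (φ : OpenPartialHomeomorph Q (Cfg m)) (c : Cfg₁ m) : ℝ :=
  - h (momPoint π φ c) (chartVec φ c.1 (1, 0))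

/-- A Hamiltonian form `H = p_i dq^i - 𝓗 dt` on `V*Q`: the pull-back of the Liouville form by a
smooth section of `T*Q → V*Q`. At `p ∈ V*Q` it is the pull-back by `V*Q → Q` of the covector
`toFun p` at the point `p.pt`, whose restriction to the vertical vectors is `p`. -/
structure HamiltonianForm (m : ℕ) {Q : Type*} [TopologicalSpace Q] [ChartedSpace (Cfg m) Q]
    (π : Q → ℝ) where
  /-- the section of `T*Q → V*Q` -/
  toFun : VCot m π → (Cfg m →L[ℝ] ℝ)
  restrict : ∀ (p : VCot m π) (w : Vert (m := m) π p.pt), toFun p (w : Cfg m) = p.mom w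
  smooth : ∀ φ : OpenPartialHomeomorph Q (Cfg m), IsFibredChart π φ →
    ContDiffOn ℝ ∞ (localHamiltonian toFun φ) (φ.target ×ˢ univ)

/-- The Hamiltonian `𝓗(t, q, p)` in a chart. -/
noncomputable def HamiltonianForm.loc (H : HamiltonianForm m π)
    (φ : OpenPartialHomeomorph Q (Cfg m)) : Cfg₁ m → ℝ :=
  localHamiltonian H.toFun φ

theorem exists_eval_eq {V : Type*} [NormedAddCommGroup V] [NormedSpace ℝ V]
    [FiniteDimensional ℝ V] (A : (V →L[ℝ] ℝ) →L[ℝ] ℝ) :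
    ∃ w : V, A = - ContinuousLinearMap.apply ℝ ℝ w := by
  let Λ : Module.Dual ℝ (Module.Dual ℝ V) :=
    (A : (V →L[ℝ] ℝ) →ₗ[ℝ] ℝ).comp
      (LinearMap.toContinuousLinearMap (𝕜 := ℝ) (E := V) (F' := ℝ)).toLinearMap
  obtain ⟨w, hw⟩ := (Module.evalEquiv ℝ V).surjective (-Λ)
  refine ⟨w, ?_⟩
  ext b
  have h1 : (Module.evalEquiv ℝ V) w (b : V →ₗ[ℝ] ℝ) = b w := rfl
  have h2 : Λ (b : V →ₗ[ℝ] ℝ) = A b := rfl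
  rw [hw, LinearMap.neg_apply, h2] at h1
  simp [← h1]

theorem exists_stationary {V : Type*} [NormedAddCommGroup V] [NormedSpace ℝ V]
    [FiniteDimensional ℝ V] (ψ : (V →L[ℝ] ℝ) → ℝ) (b : V →L[ℝ] ℝ) :
    ∃ w : V, fderiv ℝ (fun c : V →L[ℝ] ℝ => ψ c + c w) b = 0 := by
  by_cases hd : DifferentiableAt ℝ ψ b
  · obtain ⟨w, hw⟩ := exists_eval_eq (fderiv ℝ ψ b)
    refine ⟨w, ?_⟩
    have hadd : HasFDerivAt (fun c : V →L[ℝ] ℝ => ψ c + c w)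
        (fderiv ℝ ψ b + ContinuousLinearMap.apply ℝ ℝ w) b :=
      hd.hasFDerivAt.add (ContinuousLinearMap.apply ℝ ℝ w).hasFDerivAt
    rw [hadd.fderiv, hw]
    exact neg_add_cancel (ContinuousLinearMap.apply ℝ ℝ w)
  · refine ⟨0, ?_⟩
    simpa using fderiv_zero_of_not_differentiableAt hd

/-- Existence of the value of the Hamiltonian map at `p`. -/
theorem HamiltonianForm.exists_hamiltonianMap (hπ : IsFibredManifold (m := m) π)
    (H : HamiltonianForm m π) (p : VCot m π) :
    ∃ v : Cfg m, dt π p.pt v = 1 ∧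
      fderiv ℝ (fun b : Vert (m := m) π p.pt →L[ℝ] ℝ => H.toFun ⟨p.pt, b⟩ v) p.mom = 0 := by
  obtain ⟨u, hu⟩ := hπ.submersion p.pt 1
  obtain ⟨w, hw⟩ := exists_stationary
    (fun b : Vert (m := m) π p.pt →L[ℝ] ℝ => H.toFun ⟨p.pt, b⟩ u) p.mom
  refine ⟨u + (w : Cfg m), ?_, ?_⟩
  · have h : dt π p.pt (w : Cfg m) = 0 := w.2
    rw [map_add, hu, h, add_zero]
  · have key : (fun b : Vert (m := m) π p.pt →L[ℝ] ℝ => H.toFun ⟨p.pt, b⟩ (u + (w : Cfg m))) =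
        fun b => H.toFun ⟨p.pt, b⟩ u + b w := by
      funext b
      rw [map_add]
      exact congrArg _ (H.restrict ⟨p.pt, b⟩ w)
    rw [key]
    exact hw

/-- The Hamiltonian map `Ĥ : V*Q → J¹Q` over `Q`, in coordinates `q^i_t ∘ Ĥ = ∂^i 𝓗`. Without
coordinates: `Ĥ(p)` is the jet `v` at the base point of `p` for which the function
`b ↦ H_b(v) = b_i v^i - 𝓗(b)` on the fibre of `V*Q` is stationary at `b = p`. -/
noncomputable def HamiltonianForm.hamiltonianMap (hπ : IsFibredManifold (m := m) π)
    (H : HamiltonianForm m π) (p : VCot m π) : Jet m π :=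
  Jet.mk p.pt (H.exists_hamiltonianMap hπ p).choose (H.exists_hamiltonianMap hπ p).choose_spec.1

/-- `H` is weakly associated with `L`: the equality `Ĥ^* L_H = Ĥ^* L` holds on `N_L`, where
`L_H = (p_i q^i_t - 𝓗) dt` takes the value `H_p(v)` at `p ∈ V*Q` and a jet `v` over the same point
of `Q`. -/
def HamiltonianForm.WeaklyAssociated (hπ : IsFibredManifold (m := m) π)
    (H : HamiltonianForm m π) (L : Lagrangian m π) : Prop :=
  ∀ p ∈ L.constraintSpace,
    H.toFun p (H.hamiltonianMap hπ p).vel = L.toFun (H.hamiltonianMap hπ p)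

/-- `r` is a smooth section of `V*Q → ℝ` over the set `U` of instants. -/
def IsPhaseSectionOn (U : Set ℝ) (r : ℝ → VCot m π) : Prop :=
  ContMDiffOn 𝓘(ℝ, ℝ) 𝓘(ℝ, Cfg m) ∞ (fun t => (r t).pt) U ∧
  (∀ φ : OpenPartialHomeomorph Q (Cfg m), IsFibredChart π φ →
    ContDiffOn ℝ ∞ (fun t => momCoord φ (r t)) {t ∈ U | (r t).pt ∈ φ.source}) ∧
  ∀ t ∈ U, π (r t).pt = t

/-- The Hamilton equation `q^k_t = ∂^k 𝓗`, `p_{tk} = -∂_k 𝓗` for a section `r` of `V*Q → ℝ` over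
`U`. -/
def HamiltonianForm.SolvesHamilton (H : HamiltonianForm m π) (U : Set ℝ) (r : ℝ → VCot m π) :
    Prop :=
  ∀ φ : OpenPartialHomeomorph Q (Cfg m), IsFibredChart π φ →
    ∀ t ∈ U, (r t).pt ∈ φ.source → ∀ k : Fin m,
      HasDerivAt (fun τ => (momCoord φ (r τ)).1.2 k) (dv k (H.loc φ) (momCoord φ (r t))) t ∧
      HasDerivAt (fun τ => (momCoord φ (r τ)).2 k) (- dq k (H.loc φ) (momCoord φ (r t))) t

/-- The jet prolongation `J¹s` of a curve `s` in `Q`, as a curve in `TQ ⊃ J¹Q`. -/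
noncomputable def jetProlongation (m : ℕ) {Q : Type*} [TopologicalSpace Q] [ChartedSpace (Cfg m) Q]
    (s : ℝ → Q) (t : ℝ) : TangentBundle 𝓘(ℝ, Cfg m) Q :=
  ⟨s t, mfderiv 𝓘(ℝ, ℝ) 𝓘(ℝ, Cfg m) s t (1 : ℝ)⟩

end Bundles

end TimeMechanics

/-!
In fibred coordinates write `v` for the velocity coordinates of `sbar(t)`, `w = dq/dt` for the
velocity of its projection, and `z = w - v`; let `p = π(v)` be the momentum of `r(t)`, the base point
`(t, q)` being understood. By `HamiltonianForm.jetCoord_hamiltonianMap` the relation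
`Ĥ ∘ L̂ ∘ sbar = J¹s` says `w = ∂𝓗(p)`, which is the first half of the Hamilton equation. The second
half is `dp_k/dt = -∂_k 𝓗(p)`, and the second Cartan equation gives
`dp_k/dt = ∂_k 𝓛(v) + ∂_k π_j(v) z^j`. It remains to see that both right-hand sides agree with
`∂_k 𝓛(w)`.

The key point is that `L̂` is constant on the segment from `v` to `w`
(`Lagrangian.IsAlmostRegular.legendre_addVert_smul`). The first Cartan equation says that `z` is in
the kernel of the fibre Hessian at `v`, hence orthogonal to its image; since `L̂` is a submersion onto
`N_L`, `z` annihilates the vertical vectors tangent to `N_L` at `p`. A gradient map whose image is a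
submanifold is constant in such directions (`eq_along_kernel`, by Grönwall's inequality and a local
retraction onto the image).

Given this, `-∂_k 𝓗(p) = ∂_k 𝓛(w)` follows by differentiating the weak association identity
`π_i ∂^i𝓗 - 𝓗 = 𝓛(t, q, ∂𝓗)` along `L̂`, as the terms with derivatives of `∂𝓗` cancel
because `π(w) = p` (`HamiltonianForm.WeaklyAssociated.dq_loc`). And
`∂_k 𝓛(w) = ∂_k 𝓛(v) + ∂_k π_j(v) z^j` holds because the derivative of `∂_k 𝓛` along the segment,
`∂_k π_j(v + s z) z^j`, does not depend on `s`: at different points of the segment the vectors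
`∂_k π` differ by a vertical vector tangent to `N_L` at `p`, which `z` annihilates
(`Lagrangian.LegendreIsSubmersion.dq_loc_add`).
-/

namespace TimeMechanics

/-! ### Local retractions and fibres of symmetric differentials -/

/-- The image of an immersion which is a topological embedding is, near each of its points, a smooth
retract of a neighbourhood. If `B` is a linear left inverse of the differential at `f₀`, then
`B ∘ p` is a local diffeomorphism, and `R = p ∘ (B ∘ p)⁻¹ ∘ B`. The map `p` being inducing, all
points of the image near `p f₀` come from points near `f₀`, so that `R` fixes them. -/
theorem exists_local_retraction {E V F : Type*} [NormedAddCommGroup E] [NormedSpace ℝ E]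
    [CompleteSpace E] [NormedAddCommGroup V] [NormedSpace ℝ V] [FiniteDimensional ℝ V]
    [TopologicalSpace F] [ChartedSpace E F] [IsManifold 𝓘(ℝ, E) ∞ F] {p : F → V}
    (hp : ContMDiff 𝓘(ℝ, E) 𝓘(ℝ, V) ∞ p) (hind : IsInducing p) (f₀ : F)
    (hinj : Function.Injective (mfderiv 𝓘(ℝ, E) 𝓘(ℝ, V) p f₀)) :
    ∃ R : V → V, ContDiffAt ℝ ∞ R (p f₀) ∧ (∀ x, R x ∈ range p) ∧
      ∀ᶠ x in 𝓝 (p f₀), x ∈ range p → R x = x := by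
  set e := chartAt E f₀ with he_def
  have hf₀ : f₀ ∈ e.source := mem_chart_source E f₀
  have hef : e f₀ ∈ e.target := e.map_source hf₀
  have he : e.MDifferentiable 𝓘(ℝ, E) 𝓘(ℝ, E) :=
    haveI : IsManifold 𝓘(ℝ, E) 1 F := .of_le (n := ∞) (by simp)
    mdifferentiable_of_mem_atlas (chart_mem_atlas E f₀)
  have hq : ContDiffAt ℝ ∞ (p ∘ e.symm) (e f₀) := by
    rw [← contMDiffAt_iff_contDiffAt]
    exact hp.contMDiffAt.comp (e f₀)
      ((contMDiffOn_chart_symm (I := 𝓘(ℝ, E)) (n := ∞) (x := f₀)).contMDiffAt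
        (e.open_target.mem_nhds hef))
  have hDinj : Function.Injective (fderiv ℝ (p ∘ e.symm) (e f₀)) := by
    rw [← mfderiv_eq_fderiv]
    have hp' : MDifferentiableAt 𝓘(ℝ, E) 𝓘(ℝ, V) p (e.symm (e f₀)) :=
      hp.contMDiffAt.mdifferentiableAt (by simp)
    rw [mfderiv_comp (e f₀) hp' (he.mdifferentiableAt_symm hef)]
    refine Function.Injective.comp (f := mfderiv 𝓘(ℝ, E) 𝓘(ℝ, E) e.symm (e f₀)) ?_ ?_
    · rw [e.left_inv hf₀]
      exact hinj
    · intro a b hab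
      have h := he.comp_symm_deriv hef
      have := congrArg (mfderiv 𝓘(ℝ, E) 𝓘(ℝ, E) e (e.symm (e f₀))) hab
      rw [← ContinuousLinearMap.comp_apply, ← ContinuousLinearMap.comp_apply, h] at this
      exact this
  obtain ⟨B, hB⟩ := ContinuousLinearMap.HasLeftInverse.of_injective_of_finiteDimensional hDinj
  set D := fderiv ℝ (p ∘ e.symm) (e f₀) with hD
  have hBq : ContDiffAt ℝ ∞ (fun a => B (p (e.symm a))) (e f₀) :=
    B.contDiff.contDiffAt.comp (e f₀) hq
  have hBD : HasFDerivAt (fun a => B (p (e.symm a)))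
      ((ContinuousLinearEquiv.refl ℝ E : E ≃L[ℝ] E) : E →L[ℝ] E) (e f₀) := by
    have h1 := B.hasFDerivAt.comp (e f₀) (hq.differentiableAt (by simp)).hasFDerivAt
    refine h1.congr_fderiv ?_
    ext a
    exact hB a
  set θ := hBq.localInverse hBD (by simp) with hθ_def
  have hBp : B (p (e.symm (e f₀))) = B (p f₀) := by rw [e.left_inv hf₀]
  have hθ : ContDiffAt ℝ ∞ θ (B (p f₀)) := by
    rw [← hBp]; exact hBq.to_localInverse hBD (by simp)
  have hθ0 : θ (B (p f₀)) = e f₀ := by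
    rw [← hBp]; exact hBq.localInverse_apply_image hBD (by simp)
  have hθe : ∀ᶠ a in 𝓝 (e f₀), θ (B (p (e.symm a))) = a :=
    (hBq.hasStrictFDerivAt' hBD (by simp)).eventually_left_inverse
  refine ⟨fun x => p (e.symm (θ (B x))), ?_, fun x => mem_range_self _, ?_⟩
  · have h1 : ContDiffAt ℝ ∞ (fun x => θ (B x)) (p f₀) :=
      hθ.comp (p f₀) B.contDiff.contDiffAt
    have h2 : ContDiffAt ℝ ∞ (p ∘ e.symm) (θ (B (p f₀))) := by rw [hθ0]; exact hq
    exact ContDiffAt.comp (g := p ∘ e.symm) (p f₀) h2 h1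
  · have h1 : ∀ᶠ f in 𝓝 f₀, p (e.symm (θ (B (p f)))) = p f := by
      filter_upwards [e.open_source.mem_nhds hf₀, (e.continuousAt hf₀).eventually hθe]
        with f hf h
      rw [e.left_inv hf] at h
      rw [h, e.left_inv hf]
    rw [hind.nhds_eq_comap, eventually_comap] at h1
    filter_upwards [h1]
    rintro x hx ⟨f, rfl⟩
    exact hx f rfl

/-- The linear functional `y ↦ z · y` on `ℝᵐ`. -/
noncomputable def dotL {m : ℕ} (z : Fin m → ℝ) : (Fin m → ℝ) →L[ℝ] ℝ :=
  ∑ j, z j • ContinuousLinearMap.proj (R := ℝ) (φ := fun _ : Fin m => ℝ) j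

theorem dotL_apply {m : ℕ} (z y : Fin m → ℝ) : dotL z y = ∑ j, z j * y j := by
  simp [dotL]

/-- A map `g` with symmetric differential (a gradient map) is constant on the segment from `v₀` to
`v₀ + z` if `z` annihilates the tangent space of the image of `g` at `g v₀`. The image enters only
through a local retraction `R` onto it, with tangent space `range (fderiv ℝ R (g v₀))`.
Differentiating `g = R ∘ g` and using symmetry bounds `‖Dg(x) z‖` by a multiple of `‖g x - g v₀‖`
near each point of the fibre, so Grönwall's inequality propagates `g = g v₀` along the segment. -/
theorem eq_along_kernel {m : ℕ} {g : (Fin m → ℝ) → (Fin m → ℝ)} (hg : ContDiff ℝ 1 g)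
    (hsymm : ∀ v i j, fderiv ℝ g v (Pi.single i 1) j = fderiv ℝ g v (Pi.single j 1) i)
    {v₀ : Fin m → ℝ} {R : (Fin m → ℝ) → (Fin m → ℝ)} (hR : ContDiffAt ℝ 2 R (g v₀))
    (hRg : ∀ᶠ x in 𝓝 (g v₀), x ∈ range g → R x = x)
    {z : Fin m → ℝ} (hz : ∀ y, dotL z (fderiv ℝ R (g v₀) y) = 0)
    {s : ℝ} (hs : s ∈ Icc (0 : ℝ) 1) : g (v₀ + s • z) = g v₀ := by
  have hgd : Differentiable ℝ g := hg.differentiable (by simp)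
  have hgc : Continuous g := hg.continuous
  have hDc : Continuous (fderiv ℝ g) := hg.continuous_fderiv (by simp)
  -- The coordinates of `Dg(x) z` are `z · Dg(x) eᵢ = z · (DR(g x) - DR(g v₀)) Dg(x) eᵢ`, and `DR`
  -- is differentiable at `g v₀`.
  have key : ∀ v, g v = g v₀ → ∃ K : ℝ, ∀ᶠ x in 𝓝 v, ‖fderiv ℝ g x z‖ ≤ K * ‖g x - g v₀‖ := by
    intro v hv
    have hDR : DifferentiableAt ℝ (fderiv ℝ R) (g v₀) :=
      (hR.fderiv_right (m := 1) (by norm_num)).differentiableAt (by simp)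
    obtain ⟨C, hC⟩ := hDR.hasFDerivAt.isBigO_sub.bound
    have hRd : ∀ᶠ x in 𝓝 (g v₀), DifferentiableAt ℝ R x := by
      filter_upwards [hR.eventually (by simp)] with x hx using hx.differentiableAt (by simp)
    have hgt : Tendsto g (𝓝 v) (𝓝 (g v₀)) := hv ▸ hgc.continuousAt
    have hM : ∀ᶠ x in 𝓝 v, ‖fderiv ℝ g x‖ < ‖fderiv ℝ g v‖ + 1 :=
      hDc.continuousAt.norm.eventually (gt_mem_nhds (by linarith))
    refine ⟨‖dotL z‖ * (C * (‖fderiv ℝ g v‖ + 1)), ?_⟩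
    filter_upwards [hgt.eventually hC, hgt.eventually hRd, hM,
      (hgt.eventually hRg).eventually_nhds] with x hx1 hx2 hx3 hx4
    have hDg : fderiv ℝ g x = (fderiv ℝ R (g x)).comp (fderiv ℝ g x) := by
      have h1 : (fun y => R (g y)) =ᶠ[𝓝 x] g := by
        filter_upwards [hx4] with y hy using hy (mem_range_self y)
      exact (h1.fderiv_eq).symm.trans (fderiv_comp x hx2 (hgd x))
    have hcoord : ∀ i, fderiv ℝ g x z i = dotL z (fderiv ℝ g x (Pi.single i 1)) := by
      intro i
      conv_lhs => rw [pi_eq_sum_univ' z]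
      rw [map_sum, Finset.sum_apply, dotL_apply]
      refine Finset.sum_congr rfl fun j _ => ?_
      rw [map_smul, Pi.smul_apply, smul_eq_mul, ← hsymm x j i]
    have hC0 : 0 ≤ C * ‖g x - g v₀‖ := (norm_nonneg _).trans hx1
    rw [show ‖dotL z‖ * (C * (‖fderiv ℝ g v‖ + 1)) * ‖g x - g v₀‖ =
      ‖dotL z‖ * ((C * ‖g x - g v₀‖) * (‖fderiv ℝ g v‖ + 1)) by ring,
      pi_norm_le_iff_of_nonneg (mul_nonneg (norm_nonneg _) (mul_nonneg hC0 (by positivity)))]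
    intro i
    have h2 : dotL z (fderiv ℝ g x (Pi.single i 1)) =
        dotL z ((fderiv ℝ R (g x) - fderiv ℝ R (g v₀)) (fderiv ℝ g x (Pi.single i 1))) := by
      rw [sub_apply, map_sub, hz, sub_zero]
      conv_lhs => rw [hDg]
      rfl
    rw [hcoord, h2]
    have hs1 : ‖(Pi.single i 1 : Fin m → ℝ)‖ ≤ 1 := by
      rw [Pi.norm_single]; simp
    calc _ ≤ ‖dotL z‖ * (‖fderiv ℝ R (g x) - fderiv ℝ R (g v₀)‖ *
          (‖fderiv ℝ g x‖ * ‖(Pi.single i 1 : Fin m → ℝ)‖)) :=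
          (dotL z).le_opNorm_of_le (ContinuousLinearMap.le_opNorm_of_le _
            (ContinuousLinearMap.le_opNorm _ _))
      _ ≤ ‖dotL z‖ * ((C * ‖g x - g v₀‖) * ((‖fderiv ℝ g v‖ + 1) * 1)) := by
          gcongr
      _ = _ := by ring
  have hline : Continuous fun s : ℝ => v₀ + s • z := by fun_prop
  -- Continuous induction needs only the right neighbourhoods, where Grönwall's inequality applies.
  have hsub : Icc (0 : ℝ) 1 ⊆ {s | g (v₀ + s • z) = g v₀} := by
    refine IsClosed.Icc_subset_of_forall_mem_nhdsWithin ?_ (by simp) ?_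
    · exact (isClosed_eq (hgc.comp hline) continuous_const).inter isClosed_Icc
    · rintro s ⟨hs, -⟩
      obtain ⟨K, hK⟩ := key _ hs
      obtain ⟨b, hb, hbK⟩ := mem_nhdsGE_iff_exists_Icc_subset.1
        ((hline.continuousAt.eventually hK).filter_mono nhdsWithin_le_nhds)
      have hb' : s < b := hb
      have hder : ∀ x : ℝ, HasDerivAt (fun s : ℝ => g (v₀ + s • z) - g v₀)
          (fderiv ℝ g (v₀ + x • z) z) x := by
        intro x
        have h1 : HasDerivAt (fun s : ℝ => v₀ + s • z) z x := by
          simpa using ((hasDerivAt_id x).smul_const z).const_add v₀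
        exact ((hgd _).hasFDerivAt.comp_hasDerivAt x h1).sub_const _
      have h0 := eq_zero_of_abs_deriv_le_mul_abs_self_of_eq_zero_right (K := K) (a := s) (b := b)
        (f := fun s : ℝ => g (v₀ + s • z) - g v₀) (f' := fun x => fderiv ℝ g (v₀ + x • z) z)
        (fun x _ => (hder x).continuousAt.continuousWithinAt)
        (fun x _ => (hder x).hasDerivWithinAt) (sub_eq_zero.2 hs)
        (fun x hx => hbK (Ico_subset_Icc_self hx))
      exact mem_of_superset (Ioc_mem_nhdsGT hb')
        fun x hx => sub_eq_zero.1 (h0 x (Ioc_subset_Icc_self hx))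
  exact hsub hs

/-! ### Fibred coordinates on the velocity and phase spaces -/

variable {m : ℕ} {Q : Type*} [TopologicalSpace Q] [ChartedSpace (Cfg m) Q]
  {π : Q → ℝ} {φ : OpenPartialHomeomorph Q (Cfg m)}


theorem IsFibredChart.mdifferentiable (hφ : IsFibredChart π φ) :
    φ.MDifferentiable 𝓘(ℝ, Cfg m) 𝓘(ℝ, Cfg m) :=
  ⟨(contMDiffOn_of_mem_maximalAtlas hφ.1).mdifferentiableOn (by simp),
    (contMDiffOn_symm_of_mem_maximalAtlas hφ.1).mdifferentiableOn (by simp)⟩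

theorem chartVec_chartComp (hφ : IsFibredChart π φ) {x : Q}
    (hx : x ∈ φ.source) (v : Cfg m) : chartVec φ (φ x) (chartComp φ x v) = v :=
  congrArg (fun A : Cfg m →L[ℝ] Cfg m => A v) (hφ.mdifferentiable.symm_comp_deriv hx)

theorem chartComp_chartVec (hφ : IsFibredChart π φ) {x : Q}
    (hx : x ∈ φ.source) (v : Cfg m) : chartComp φ x (chartVec φ (φ x) v) = v := by
  have h := hφ.mdifferentiable.comp_symm_deriv (φ.map_source hx)
  rw [φ.left_inv hx] at h
  exact congrArg (fun A : Cfg m →L[ℝ] Cfg m => A v) h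

theorem dt_eq_chartComp (hφ : IsFibredChart π φ) {x : Q}
    (hx : x ∈ φ.source) (v : Cfg m) : dt π x v = (chartComp φ x v).1 := by
  have h := dt_chartVec hφ (φ.map_source hx) (chartComp φ x v)
  rwa [chartVec_chartComp hφ hx, φ.left_inv hx] at h

theorem Jet.ext {z z' : Jet m π} (hpt : z.pt = z'.pt) (hvel : z.vel = z'.vel) : z = z' := by
  rcases z with ⟨⟨x, v⟩, h⟩
  rcases z' with ⟨⟨x', v'⟩, h'⟩
  obtain rfl : x = x' := hpt
  obtain rfl : v = v' := hvel
  rfl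

theorem VCot.eval_coe (p : VCot m π) (w : Vert (m := m) π p.pt) : p.eval (w : Cfg m) = p.mom w :=
  dif_pos w.2

theorem VCot.ext {p p' : VCot m π} (hpt : p.pt = p'.pt)
    (heval : ∀ v ∈ Vert (m := m) π p.pt, p.eval v = p'.eval v) : p = p' := by
  rcases p with ⟨x, b⟩
  rcases p' with ⟨x', b'⟩
  obtain rfl : x = x' := hpt
  congr 1
  ext w
  have h := heval w w.2
  rwa [VCot.eval_coe ⟨x, b⟩ w, VCot.eval_coe ⟨x, b'⟩ w] at h

theorem Jet.chartComp_vel (hφ : IsFibredChart π φ) (z : Jet m π)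
    (hz : z.pt ∈ φ.source) : chartComp φ z.pt z.vel = (1, (jetCoord φ z).2) :=
  Prod.ext ((dt_eq_chartComp hφ hz _).symm.trans z.dt_vel) rfl

theorem chartComp_vert (hφ : IsFibredChart π φ) {x : Q}
    (hx : x ∈ φ.source) (w : Vert (m := m) π x) :
    chartComp φ x (w : Cfg m) = (0, (chartComp φ x (w : Cfg m)).2) :=
  Prod.ext ((dt_eq_chartComp hφ hx _).symm.trans w.2) rfl

theorem chartVec_mem_vert (hφ : IsFibredChart π φ) {x : Q}
    (hx : x ∈ φ.source) (a : Fin m → ℝ) : chartVec φ (φ x) (0, a) ∈ Vert (m := m) π x := by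
  show dt π x _ = 0
  rw [dt_eq_chartComp hφ hx, chartComp_chartVec hφ hx]

/-- The jet `∂_t + q^i_t ∂_i` with the coordinates `c = (t, q, q_t)` in the fibred chart `φ`. -/
noncomputable def jetPoint (hφ : IsFibredChart π φ) (c : Cfg₁ m) (hc : c.1 ∈ φ.target) : Jet m π :=
  Jet.mk (φ.symm c.1) (chartVec φ c.1 (1, c.2)) (dt_chartVec hφ hc _)

theorem jetPoint_pt_mem (hφ : IsFibredChart π φ) {c : Cfg₁ m} (hc : c.1 ∈ φ.target) :
    (jetPoint hφ c hc).pt ∈ φ.source := φ.map_target hc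

theorem jetCoord_jetPoint (hφ : IsFibredChart π φ) {c : Cfg₁ m}
    (hc : c.1 ∈ φ.target) : jetCoord φ (jetPoint hφ c hc) = c := by
  refine Prod.ext (φ.right_inv hc) ?_
  have h := chartComp_chartVec hφ (φ.map_target hc) (1, c.2)
  rw [φ.right_inv hc] at h
  show (chartComp φ (φ.symm c.1) (chartVec φ c.1 (1, c.2))).2 = c.2
  rw [h]

theorem jetPoint_jetCoord (hφ : IsFibredChart π φ) {z : Jet m π}
    (hz : z.pt ∈ φ.source) : jetPoint hφ (jetCoord φ z) (φ.map_source hz) = z := by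
  refine Jet.ext (φ.left_inv hz) ?_
  show chartVec φ (φ z.pt) (1, (jetCoord φ z).2) = z.vel
  rw [← z.chartComp_vel hφ hz, chartVec_chartComp hφ hz]

theorem Lagrangian.loc_eq (L : Lagrangian m π) (hφ : IsFibredChart π φ) {c : Cfg₁ m}
    (hc : c.1 ∈ φ.target) : L.loc φ c = L.toFun (jetPoint hφ c hc) :=
  dif_pos (dt_chartVec hφ hc _)

theorem Lagrangian.loc_jetCoord (L : Lagrangian m π)
    (hφ : IsFibredChart π φ) {z : Jet m π} (hz : z.pt ∈ φ.source) :
    L.loc φ (jetCoord φ z) = L.toFun z := by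
  rw [L.loc_eq hφ (φ.map_source hz), jetPoint_jetCoord hφ hz]

theorem Lagrangian.contDiffAt_loc (L : Lagrangian m π) (hφ : IsFibredChart π φ) {c : Cfg₁ m}
    (hc : c.1 ∈ φ.target) : ContDiffAt ℝ ∞ (L.loc φ) c :=
  (L.smooth φ hφ).contDiffAt ((φ.open_target.prod isOpen_univ).mem_nhds ⟨hc, mem_univ _⟩)

theorem HamiltonianForm.contDiffAt_loc (H : HamiltonianForm m π) (hφ : IsFibredChart π φ)
    {c : Cfg₁ m} (hc : c.1 ∈ φ.target) : ContDiffAt ℝ ∞ (H.loc φ) c :=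
  (H.smooth φ hφ).contDiffAt ((φ.open_target.prod isOpen_univ).mem_nhds ⟨hc, mem_univ _⟩)

theorem jetCoord_addVert (z : Jet m π) (w : Vert (m := m) π z.pt) :
    jetCoord φ (z.addVert w) = jetCoord φ z + (0, (chartComp φ z.pt (w : Cfg m)).2) := by
  refine Prod.ext (add_zero _).symm ?_
  show (chartComp φ z.pt (z.vel + w)).2 = _
  rw [map_add]
  rfl

theorem Lagrangian.legendre_eval (L : Lagrangian m π)
    (hφ : IsFibredChart π φ) {z : Jet m π} (hz : z.pt ∈ φ.source) (w : Vert (m := m) π z.pt) :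
    (L.legendre z).eval (w : Cfg m) =
      fderiv ℝ (L.loc φ) (jetCoord φ z) (0, (chartComp φ z.pt (w : Cfg m)).2) := by
  rw [(L.legendre z).eval_coe w]
  let A : Vert (m := m) π z.pt →L[ℝ] Cfg₁ m :=
    (ContinuousLinearMap.inr ℝ (Cfg m) (Fin m → ℝ)).comp
      ((ContinuousLinearMap.snd ℝ ℝ (Fin m → ℝ)).comp
        ((chartComp φ z.pt).comp (Vert (m := m) π z.pt).subtypeL))
  have hA : ∀ w, jetCoord φ (z.addVert w) = jetCoord φ z + A w := fun w => jetCoord_addVert z w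
  have hfun : (fun w : Vert (m := m) π z.pt => L.toFun (z.addVert w)) =
      fun w => L.loc φ (jetCoord φ z + A w) := by
    funext w
    rw [← hA, L.loc_jetCoord hφ (z := z.addVert w) hz]
  have hd : HasFDerivAt (fun w => jetCoord φ z + A w) A 0 := A.hasFDerivAt.const_add _
  have hl : HasFDerivAt (L.loc φ) (fderiv ℝ (L.loc φ) (jetCoord φ z)) (jetCoord φ z + A 0) := by
    rw [map_zero, add_zero]
    exact ((L.contDiffAt_loc hφ (φ.map_source hz)).differentiableAt (by simp)).hasFDerivAt
  show fderiv ℝ (fun w : Vert (m := m) π z.pt => L.toFun (z.addVert w)) 0 w = _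
  have h := (hl.comp 0 hd).fderiv
  rw [Function.comp_def] at h
  rw [hfun, h]
  rfl

theorem Lagrangian.momCoord_legendre (L : Lagrangian m π)
    (hφ : IsFibredChart π φ) {z : Jet m π} (hz : z.pt ∈ φ.source) :
    momCoord φ (L.legendre z) = L.legendreLoc φ (jetCoord φ z) := by
  refine Prod.ext rfl (funext fun i => ?_)
  have h := L.legendre_eval hφ hz ⟨_, chartVec_mem_vert hφ hz (Pi.single i 1)⟩
  rw [chartComp_chartVec hφ hz] at h
  exact h

theorem VCot.eval_eq_sum (hφ : IsFibredChart π φ) (p : VCot m π)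
    (hp : p.pt ∈ φ.source) (a : Fin m → ℝ) :
    p.eval (chartVec φ (φ p.pt) (0, a)) = ∑ i, a i * (momCoord φ p).2 i := by
  have h1 : ∀ a, p.eval (chartVec φ (φ p.pt) (0, a)) =
      p.mom ⟨_, chartVec_mem_vert hφ hp a⟩ := fun a => p.eval_coe ⟨_, chartVec_mem_vert hφ hp a⟩
  simp only [momCoord, h1, ← smul_eq_mul, ← map_smul, ← map_sum]
  congr 1
  ext1
  rw [AddSubmonoidClass.coe_finsetSum]
  simp only [SetLike.mk_smul_mk, ← map_smul, ← map_sum]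
  congr 1
  refine Prod.ext (by simp [Prod.fst_sum]) ?_
  ext j
  simp [Prod.snd_sum, Pi.single_apply]

theorem momPoint_momCoord (hφ : IsFibredChart π φ) {p : VCot m π}
    (hp : p.pt ∈ φ.source) : momPoint π φ (momCoord φ p) = p := by
  have hpt : (momPoint π φ (momCoord φ p)).pt = p.pt := φ.left_inv hp
  refine VCot.ext hpt fun v hv => ?_
  rw [VCot.eval_coe _ ⟨v, hv⟩]
  rw [hpt] at hv
  have h2 : chartVec φ (φ p.pt) (0, (chartComp φ p.pt v).2) = v := by
    rw [← chartComp_vert hφ hp ⟨v, hv⟩]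
    exact chartVec_chartComp hφ hp v
  conv_rhs => rw [← h2, p.eval_eq_sum hφ hp]
  have hpt' : φ.symm (momCoord φ p).1 = p.pt := hpt
  show dotL (momCoord φ p).2 (chartComp φ (φ.symm (momCoord φ p).1) v).2 = _
  rw [hpt', dotL_apply]
  exact Finset.sum_congr rfl fun i _ => mul_comm _ _

theorem momCoord_injOn (hφ : IsFibredChart π φ) :
    InjOn (momCoord φ) {p : VCot m π | p.pt ∈ φ.source} := fun p hp p' hp' h => by
  rw [← momPoint_momCoord hφ hp, h, momPoint_momCoord hφ hp']

theorem Lagrangian.legendreLoc_mem (L : Lagrangian m π)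
    (hφ : IsFibredChart π φ) {c : Cfg₁ m} (hc : c.1 ∈ φ.target) :
    L.legendreLoc φ c ∈ inCoord φ L.constraintSpace := by
  refine ⟨hc, ?_⟩
  have hz := jetPoint_pt_mem hφ hc
  have h := L.momCoord_legendre hφ hz
  rw [jetCoord_jetPoint hφ hc] at h
  rw [← h, momPoint_momCoord hφ (p := L.legendre (jetPoint hφ c hc)) hz]
  exact mem_range_self _

/-! ### Hamiltonian forms in coordinates -/

/-- The value of the Hamiltonian form on the jet `∂_t + a^i ∂_i` is `p_i a^i - 𝓗`. -/
theorem HamiltonianForm.toFun_chartVec (H : HamiltonianForm m π)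
    (hφ : IsFibredChart π φ) {p : VCot m π} (hp : p.pt ∈ φ.source) (a : Fin m → ℝ) :
    H.toFun p (chartVec φ (φ p.pt) (1, a)) =
      ∑ i, a i * (momCoord φ p).2 i - H.loc φ (momCoord φ p) := by
  have h1 : ((1, a) : Cfg m) = (1, 0) + (0, a) := by simp
  rw [h1, map_add, map_add, H.restrict p ⟨_, chartVec_mem_vert hφ hp a⟩,
    ← p.eval_coe ⟨_, chartVec_mem_vert hφ hp a⟩, p.eval_eq_sum hφ hp,
    HamiltonianForm.loc, localHamiltonian, momPoint_momCoord hφ hp]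
  show _ + _ = _ - -(H.toFun p (chartVec φ (φ p.pt) (1, 0)))
  ring

theorem fderiv_dotL_sub_comp {V : Type*} [NormedAddCommGroup V] [NormedSpace ℝ V]
    (β : V →L[ℝ] (Fin m → ℝ)) (a : Fin m → ℝ) {h : Cfg₁ m → ℝ} {y : Cfg m} {b : V}
    (hd : DifferentiableAt ℝ h (y, β b)) (δ : V) :
    fderiv ℝ (fun b => dotL a (β b) - h (y, β b)) b δ =
      dotL a (β δ) - fderiv ℝ h (y, β b) (0, β δ) := by
  have h1 : HasFDerivAt (fun b => ((y, β b) : Cfg₁ m))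
      ((ContinuousLinearMap.inr ℝ (Cfg m) (Fin m → ℝ)).comp β) b :=
    (hasFDerivAt_prodMk_right y (β b)).comp b β.hasFDerivAt
  have h2 := (((dotL a).comp β).hasFDerivAt (x := b)).fun_sub (hd.hasFDerivAt.comp b h1)
  exact congrArg (fun T => T δ) h2.fderiv

/-- The coordinate expression `q^k_t ∘ Ĥ = ∂^k 𝓗` of the Hamiltonian map: on a fibre of `V*Q` the
function `b ↦ b_i v^i - 𝓗(b)` is stationary only if `v^k = ∂^k 𝓗`. -/
theorem HamiltonianForm.jetCoord_hamiltonianMap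
    (hπ : IsFibredManifold (m := m) π) (H : HamiltonianForm m π)
    (hφ : IsFibredChart π φ) {p : VCot m π} (hp : p.pt ∈ φ.source) :
    jetCoord φ (H.hamiltonianMap hπ p) = (φ p.pt, fun k => dv k (H.loc φ) (momCoord φ p)) := by
  refine Prod.ext rfl (funext fun k => ?_)
  set z := H.hamiltonianMap hπ p with hz
  have hzs : z.pt ∈ φ.source := hp
  set a := (jetCoord φ z).2 with ha
  have hv : z.vel = chartVec φ (φ p.pt) (1, a) := by
    rw [ha, ← z.chartComp_vel hφ hzs]
    exact (chartVec_chartComp hφ hzs _).symm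
  have h0 : fderiv ℝ (fun b : Vert (m := m) π p.pt →L[ℝ] ℝ => H.toFun ⟨p.pt, b⟩ z.vel) p.mom = 0 :=
    (H.exists_hamiltonianMap hπ p).choose_spec.2
  let β : (Vert (m := m) π p.pt →L[ℝ] ℝ) →L[ℝ] (Fin m → ℝ) :=
    ContinuousLinearMap.pi fun i : Fin m =>
      ContinuousLinearMap.apply ℝ ℝ ⟨_, chartVec_mem_vert hφ hp (Pi.single i 1)⟩
  have hβ : ∀ b, momCoord φ (⟨p.pt, b⟩ : VCot m π) = (φ p.pt, β b) := fun b =>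
    Prod.ext rfl (funext fun i =>
      VCot.eval_coe ⟨p.pt, b⟩ ⟨_, chartVec_mem_vert hφ hp (Pi.single i 1)⟩)
  have hfun : (fun b : Vert (m := m) π p.pt →L[ℝ] ℝ => H.toFun ⟨p.pt, b⟩ z.vel) =
      fun b => dotL a (β b) - H.loc φ (φ p.pt, β b) := by
    funext b
    rw [hv, H.toFun_chartVec hφ (p := ⟨p.pt, b⟩) hp a, hβ, dotL_apply]
  have hp0 : momCoord φ p = (φ p.pt, β p.mom) := hβ p.mom
  have hd : DifferentiableAt ℝ (H.loc φ) (φ p.pt, β p.mom) :=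
    (H.contDiffAt_loc hφ (c := (φ p.pt, β p.mom)) (φ.map_source hp)).differentiableAt (by simp)
  -- The restriction of `dq^k` to the vertical vectors.
  let δ : Vert (m := m) π p.pt →L[ℝ] ℝ :=
    (ContinuousLinearMap.proj (R := ℝ) (φ := fun _ : Fin m => ℝ) k).comp
      ((ContinuousLinearMap.snd ℝ ℝ (Fin m → ℝ)).comp
        ((chartComp φ p.pt).comp (Vert (m := m) π p.pt).subtypeL))
  have hδ : β δ = Pi.single k 1 := by
    funext i
    show (chartComp φ p.pt (chartVec φ (φ p.pt) (0, Pi.single i 1))).2 k = _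
    rw [chartComp_chartVec hφ hp]
    simp [Pi.single_apply, eq_comm]
  rw [hfun] at h0
  have h2 := fderiv_dotL_sub_comp β a hd δ
  rw [h0, ← hp0] at h2
  rw [hδ, dotL_apply] at h2
  simp only [Pi.single_apply, mul_ite, mul_one, mul_zero, Finset.sum_ite_eq',
    Finset.mem_univ, if_true] at h2
  exact (sub_eq_zero.1 h2.symm)

/-- Weak association in coordinates, `p_i ∂^i𝓗 - 𝓗 = 𝓛(t, q, ∂𝓗)` on `N_L`, pulled back by the
Legendre map, so that it holds on an open set of coordinates `(t, q, q_t)`. -/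
theorem HamiltonianForm.WeaklyAssociated.loc
    {hπ : IsFibredManifold (m := m) π} {H : HamiltonianForm m π} {L : Lagrangian m π}
    (hH : H.WeaklyAssociated hπ L) (hφ : IsFibredChart π φ) {c : Cfg₁ m} (hc : c.1 ∈ φ.target) :
    ∑ i, dv i (H.loc φ) (L.legendreLoc φ c) * dv i (L.loc φ) c - H.loc φ (L.legendreLoc φ c) =
      L.loc φ (c.1, fun k => dv k (H.loc φ) (L.legendreLoc φ c)) := by
  have hz := jetPoint_pt_mem hφ hc
  set z := jetPoint hφ c hc with hz_def
  have hm : momCoord φ (L.legendre z) = L.legendreLoc φ c := by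
    rw [L.momCoord_legendre hφ hz, jetCoord_jetPoint hφ hc]
  have h := hH (L.legendre z) (mem_range_self z)
  set y := H.hamiltonianMap hπ (L.legendre z) with hy
  have hys : y.pt ∈ φ.source := hz
  have hyc := H.jetCoord_hamiltonianMap hπ hφ (p := L.legendre z) hz
  rw [hm] at hyc
  have hv : y.vel = chartVec φ (φ z.pt) (1, (jetCoord φ y).2) := by
    rw [← y.chartComp_vel hφ hys]
    exact (chartVec_chartComp hφ hys _).symm
  have hpt : φ (L.legendre z).pt = c.1 := φ.right_inv hc
  have h1 := H.toFun_chartVec hφ (p := L.legendre z) hz (jetCoord φ y).2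
  rw [hm, hpt] at h1
  rw [hpt] at hyc
  rw [← L.loc_jetCoord hφ hys, hv] at h
  have h2 := h1.symm.trans
    ((congrArg (fun x => H.toFun (L.legendre z) (chartVec φ x _)) hpt.symm).trans h)
  rw [hy, hyc] at h2
  exact h2


/-! ### Derivatives of the Lagrangian and of the Legendre map -/

theorem two_le_infty : (2 : WithTop ℕ∞) ≤ ∞ := WithTop.coe_le_coe.2 (le_top : (2 : ℕ∞) ≤ ⊤)

theorem fderiv_apply_eq_add_sum_dv (f : Cfg₁ m → ℝ) (c : Cfg₁ m) (e : Cfg m) (a : Fin m → ℝ) :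
    fderiv ℝ f c (e, a) = fderiv ℝ f c (e, 0) + ∑ i, a i * dv i f c := by
  have h : ((e, a) : Cfg₁ m) = (e, 0) + ∑ i, a i • (0, Pi.single i 1) := by
    refine Prod.ext (by simp [Prod.fst_sum]) ?_
    ext j
    simp [Prod.snd_sum, Pi.single_apply]
  rw [h, map_add, map_sum]
  simp only [map_smul, smul_eq_mul, dv]

theorem contDiffAt_fderiv_apply {E : Type*} [NormedAddCommGroup E] [NormedSpace ℝ E]
    {f : E → ℝ} {c : E} (hf : ContDiffAt ℝ ∞ f c) (e : E) :
    ContDiffAt ℝ ∞ (fun c => fderiv ℝ f c e) c :=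
  (hf.fderiv_right (m := ∞) (by simp)).clm_apply contDiffAt_const

theorem fderiv_fderiv_comm {E : Type*} [NormedAddCommGroup E] [NormedSpace ℝ E]
    {f : E → ℝ} {c : E} (hf : ContDiffAt ℝ ∞ f c) (a b : E) :
    fderiv ℝ (fun c => fderiv ℝ f c a) c b = fderiv ℝ (fun c => fderiv ℝ f c b) c a := by
  have hd : DifferentiableAt ℝ (fderiv ℝ f) c :=
    (hf.fderiv_right (m := ∞) (by simp)).differentiableAt (by simp)
  have h : ∀ a b : E, fderiv ℝ (fun c => fderiv ℝ f c a) c b =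
      fderiv ℝ (fderiv ℝ f) c b a := fun a b => by
    rw [fderiv_clm_apply hd (differentiableAt_const a)]
    simp
  rw [h, h]
  exact (hf.isSymmSndFDerivAt (by simpa using two_le_infty)) b a

theorem Lagrangian.contDiffAt_dv (L : Lagrangian m π) (hφ : IsFibredChart π φ) {c : Cfg₁ m}
    (hc : c.1 ∈ φ.target) (i : Fin m) : ContDiffAt ℝ ∞ (dv i (L.loc φ)) c :=
  contDiffAt_fderiv_apply (L.contDiffAt_loc hφ hc) _

theorem Lagrangian.contDiffAt_legendreLoc (L : Lagrangian m π) (hφ : IsFibredChart π φ)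
    {c : Cfg₁ m} (hc : c.1 ∈ φ.target) : ContDiffAt ℝ ∞ (L.legendreLoc φ) c :=
  contDiffAt_fst.prodMk (contDiffAt_pi.2 fun i => L.contDiffAt_dv hφ hc i)

theorem Lagrangian.hasFDerivAt_legendreLoc (L : Lagrangian m π) (hφ : IsFibredChart π φ)
    {c : Cfg₁ m} (hc : c.1 ∈ φ.target) :
    HasFDerivAt (L.legendreLoc φ) ((ContinuousLinearMap.fst ℝ (Cfg m) (Fin m → ℝ)).prod
      (ContinuousLinearMap.pi fun i => fderiv ℝ (dv i (L.loc φ)) c)) c :=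
  hasFDerivAt_fst.prodMk (hasFDerivAt_pi.2 fun i =>
    ((L.contDiffAt_dv hφ hc i).differentiableAt (by simp)).hasFDerivAt)

/-! ### Fibres of the Legendre map -/

/-- If `ζ` is in the kernel of the fibre Hessian of `𝓛` at `c`, the pairing of `ζ` with the momentum
part of a vector tangent to `N_L` at `L̂(c)` depends only on the projection of this vector to `Q`.
Such a vector is the image of some `(e, a)` under the tangent map at `c`, and the pairing of `ζ`
with the contribution of `a` vanishes by the choice of `ζ`. -/
theorem Lagrangian.LegendreIsSubmersion.dotL_deriv {L : Lagrangian m π}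
    (hL : L.LegendreIsSubmersion) (hφ : IsFibredChart π φ) {c : Cfg₁ m} (hc : c.1 ∈ φ.target)
    {ζ : Fin m → ℝ} (hζ : ∀ i, ∑ j, dv i (dv j (L.loc φ)) c * ζ j = 0)
    {γ : ℝ → Cfg₁ m} (hγ : ContDiffAt ℝ ∞ γ 0) (hγ0 : γ 0 = L.legendreLoc φ c)
    (hγN : ∀ᶠ τ in 𝓝 (0 : ℝ), γ τ ∈ inCoord φ L.constraintSpace) :
    dotL ζ (deriv γ 0).2 = ∑ j, fderiv ℝ (dv j (L.loc φ)) c ((deriv γ 0).1, 0) * ζ j := by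
  obtain ⟨⟨e, a⟩, hX⟩ := hL φ hφ c hc γ hγ hγ0 hγN
  rw [(L.hasFDerivAt_legendreLoc hφ hc).fderiv] at hX
  have h1 : (deriv γ 0).1 = e := by rw [← hX]; rfl
  have h2 : ∀ j, (deriv γ 0).2 j = fderiv ℝ (dv j (L.loc φ)) c (e, a) := by
    intro j; rw [← hX]; rfl
  rw [dotL_apply, h1]
  simp only [h2, fderiv_apply_eq_add_sum_dv _ c e a, mul_add, Finset.sum_add_distrib]
  have h3 : ∑ j, ζ j * ∑ i, a i * dv i (dv j (L.loc φ)) c = 0 := by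
    simp only [Finset.mul_sum]
    rw [Finset.sum_comm]
    refine Finset.sum_eq_zero fun i _ => ?_
    have := congrArg (fun x => a i * x) (hζ i)
    simp only [Finset.mul_sum, mul_zero] at this
    rw [← this]
    exact Finset.sum_congr rfl fun j _ => by ring
  rw [h3, add_zero]
  exact Finset.sum_congr rfl fun j _ => mul_comm _ _

/-- In a suitable fibred chart around `x`, the fibre over `x` of an imbedded subbundle is a local
smooth retract of the momentum space. -/
theorem IsImbeddedSubbundle.exists_fibre_retraction
    {N : Set (VCot m π)} (hN : IsImbeddedSubbundle N) (x : Q) :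
    ∃ φ : OpenPartialHomeomorph Q (Cfg m), IsFibredChart π φ ∧ x ∈ φ.source ∧
      ∀ p : Fin m → ℝ, (φ x, p) ∈ inCoord φ N → ∃ R : (Fin m → ℝ) → (Fin m → ℝ),
        ContDiffAt ℝ ∞ R p ∧ (∀ v, (φ x, R v) ∈ inCoord φ N) ∧
        ∀ᶠ v in 𝓝 p, (φ x, v) ∈ inCoord φ N → R v = v := by
  obtain ⟨φ, hφ, hx, k, F, tF, cF, mF, P, hP, hPinj, hPemb, hPrange⟩ := hN x
  refine ⟨φ, hφ, hx, fun p hp => ?_⟩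
  have hy : φ x ∈ φ.target := φ.map_source hx
  set y : φ.target := ⟨φ x, hy⟩ with hy_def
  have hrange : ∀ v, v ∈ range (fun f : F => P (φ x, f)) ↔ (φ x, v) ∈ inCoord φ N := by
    intro v
    rw [← hPrange]
    constructor
    · rintro ⟨f, rfl⟩
      exact ⟨(y, f), rfl⟩
    · rintro ⟨⟨⟨y', hy'⟩, f⟩, h⟩
      obtain ⟨rfl, h2⟩ := Prod.ext_iff.1 h
      exact ⟨f, h2⟩
  have hsm : ContMDiff 𝓘(ℝ, EuclideanSpace ℝ (Fin k)) 𝓘(ℝ, Fin m → ℝ) ∞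
      (fun f : F => P (φ x, f)) := by
    rw [← contMDiffOn_univ]
    exact hP.comp (contMDiff_const.prodMk contMDiff_id).contMDiffOn fun f _ => ⟨hy, mem_univ _⟩
  have hind : IsInducing (fun f : F => P (φ x, f)) := by
    have h1 := hPemb.isInducing.comp (isInducing_prodMkRight y)
    have h2 : Continuous (fun v : Fin m → ℝ => ((φ x, v) : Cfg₁ m)) := by fun_prop
    exact IsInducing.of_comp hsm.continuous h2 h1
  obtain ⟨f₀, rfl⟩ := (hrange p).2 hp
  obtain ⟨R, hR1, hR2, hR3⟩ := exists_local_retraction hsm hind f₀ (hPinj _ hy f₀)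
  refine ⟨R, hR1, fun v => (hrange _).1 (hR2 v), ?_⟩
  filter_upwards [hR3] with v hv hvN using hv ((hrange v).2 hvN)

/-- For an almost regular Lagrangian, moving a jet along a vertical vector in the kernel of the fibre
Hessian does not change its Legendre image. The hypothesis is required in all fibred charts because
the proof uses the chart which trivializes the constraint space. -/
theorem Lagrangian.IsAlmostRegular.legendre_addVert_smul [IsManifold 𝓘(ℝ, Cfg m) ∞ Q]
    {L : Lagrangian m π} (hL : L.IsAlmostRegular) {z : Jet m π} {u : Vert (m := m) π z.pt}
    (hu : ∀ φ : OpenPartialHomeomorph Q (Cfg m), IsFibredChart π φ → z.pt ∈ φ.source → ∀ i,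
      ∑ j, dv i (dv j (L.loc φ)) (jetCoord φ z) * (chartComp φ z.pt (u : Cfg m)).2 j = 0)
    {s : ℝ} (hs : s ∈ Icc (0 : ℝ) 1) : L.legendre (z.addVert (s • u)) = L.legendre z := by
  obtain ⟨φ, hφ, hz, hret⟩ := hL.subbundle.exists_fibre_retraction z.pt
  have hy : φ z.pt ∈ φ.target := φ.map_source hz
  set ζ := (chartComp φ z.pt (u : Cfg m)).2 with hζ
  set v₀ := (jetCoord φ z).2 with hv₀
  have hc : jetCoord φ z = (φ z.pt, v₀) := rfl
  set g : (Fin m → ℝ) → (Fin m → ℝ) := fun v i => dv i (L.loc φ) (φ z.pt, v) with hg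
  have hgN : ∀ v, (φ z.pt, g v) ∈ inCoord φ L.constraintSpace := fun v =>
    L.legendreLoc_mem hφ (c := (φ z.pt, v)) hy
  obtain ⟨R, hR, hRN, hRg⟩ := hret (g v₀) (hgN v₀)
  have hR0 : R (g v₀) = g v₀ := hRg.self_of_nhds (hgN v₀)
  have hgi : ∀ v i, HasFDerivAt (fun v => g v i) ((fderiv ℝ (dv i (L.loc φ)) (φ z.pt, v)).comp
      (ContinuousLinearMap.inr ℝ (Cfg m) (Fin m → ℝ))) v := fun v i =>
    (((L.contDiffAt_dv hφ (c := (φ z.pt, v)) hy i).differentiableAt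
      (by simp)).hasFDerivAt).comp v (hasFDerivAt_prodMk_right (φ z.pt) v)
  have hgs : ContDiff ℝ 1 g := contDiff_pi.2 fun i => contDiff_iff_contDiffAt.2 fun v =>
    ((L.contDiffAt_dv hφ (c := (φ z.pt, v)) hy i).of_le (by simp)).comp v
      (contDiffAt_const.prodMk contDiffAt_id)
  have hsymm : ∀ v i j, fderiv ℝ g v (Pi.single i 1) j = fderiv ℝ g v (Pi.single j 1) i := by
    intro v i j
    rw [(hasFDerivAt_pi.2 fun i => hgi v i).fderiv]
    exact fderiv_fderiv_comm (L.contDiffAt_loc hφ (c := (φ z.pt, v)) hy) _ _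
  -- The curve `τ ↦ R (g v₀ + τ y)` lies in the constraint space over the fixed base point.
  have hperp : ∀ y, dotL ζ (fderiv ℝ R (g v₀) y) = 0 := by
    intro y
    have hline : HasDerivAt (fun τ : ℝ => g v₀ + τ • y) y 0 := by
      simpa using ((hasDerivAt_id (0 : ℝ)).smul_const y).const_add (g v₀)
    have h00 : g v₀ + (0 : ℝ) • y = g v₀ := by simp
    have hγd : HasDerivAt (fun τ : ℝ => ((φ z.pt, R (g v₀ + τ • y)) : Cfg₁ m))
        (0, fderiv ℝ R (g v₀) y) 0 := by
      refine (hasDerivAt_const (0 : ℝ) (φ z.pt)).prodMk ?_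
      refine HasFDerivAt.comp_hasDerivAt (0 : ℝ) ?_ hline
      rw [h00]
      exact (hR.differentiableAt (by simp)).hasFDerivAt
    have hγs : ContDiffAt ℝ ∞ (fun τ : ℝ => ((φ z.pt, R (g v₀ + τ • y)) : Cfg₁ m)) 0 := by
      refine contDiffAt_const.prodMk (ContDiffAt.comp (0 : ℝ) ?_ ?_)
      · rw [h00]; exact hR
      · exact contDiffAt_const.add (contDiffAt_id.smul contDiffAt_const)
    have h := hL.submersion.dotL_deriv hφ (c := jetCoord φ z) hy (hu φ hφ hz) hγs
      (by simp only [h00, hR0]; rfl) (Eventually.of_forall fun τ => hRN _)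
    rw [hγd.deriv] at h
    rw [h]
    refine Finset.sum_eq_zero fun j _ => ?_
    have : ((0, 0) : Cfg₁ m) = 0 := rfl
    simp only [this, map_zero, zero_mul]
  have hfib := eq_along_kernel hgs hsymm (hR.of_le two_le_infty)
    (by filter_upwards [hRg] with x hx
        rintro ⟨v, rfl⟩
        exact hx (hgN v)) hperp hs
  refine momCoord_injOn hφ hz hz ?_
  rw [L.momCoord_legendre hφ hz, L.momCoord_legendre hφ (z := z.addVert (s • u)) hz,
    jetCoord_addVert]
  have h1 : jetCoord φ z + (0, (chartComp φ z.pt ((s • u : Vert (m := m) π z.pt) : Cfg m)).2) =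
      (φ z.pt, v₀ + s • ζ) := by
    rw [hc, Prod.mk_add_mk, add_zero, Submodule.coe_smul, map_smul]
    rfl
  rw [h1, hc]
  exact Prod.ext rfl hfib

/-! ### Horizontal derivatives of the Lagrangian and of the Hamiltonian -/

/-- Along a segment with direction `ζ` in a fibre of the Legendre map, `∂_k 𝓛` is affine, with slope
`∂_k π_j ζ^j` at the initial point: the slope at any point of the segment is the pairing of `ζ` with
a vector tangent to `N_L` at the same point `L̂(y, v)` and with the same projection to `Q`. -/
theorem Lagrangian.LegendreIsSubmersion.dq_loc_add {L : Lagrangian m π}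
    (hL : L.LegendreIsSubmersion) (hφ : IsFibredChart π φ) {y : Cfg m} {v ζ : Fin m → ℝ}
    (hy : y ∈ φ.target) (hζ : ∀ i, ∑ j, dv i (dv j (L.loc φ)) (y, v) * ζ j = 0)
    (hfib : ∀ s ∈ Icc (0 : ℝ) 1, L.legendreLoc φ (y, v + s • ζ) = L.legendreLoc φ (y, v))
    (k : Fin m) :
    dq k (L.loc φ) (y, v + ζ) =
      dq k (L.loc φ) (y, v) + ∑ j, dq k (dv j (L.loc φ)) (y, v) * ζ j := by
  set e : Cfg₁ m := ((0, Pi.single k 1), 0) with he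
  set C := ∑ j, dq k (dv j (L.loc φ)) (y, v) * ζ j with hC
  have hslope : ∀ s ∈ Icc (0 : ℝ) 1,
      ∑ j, dq k (dv j (L.loc φ)) (y, v + s • ζ) * ζ j = C := by
    intro s hs
    have hys : ((y, v + s • ζ) : Cfg₁ m).1 ∈ φ.target := hy
    have hline : HasDerivAt (fun τ : ℝ => ((y, v + s • ζ) : Cfg₁ m) + τ • e) e 0 := by
      simpa using ((hasDerivAt_id (0 : ℝ)).smul_const e).const_add ((y, v + s • ζ) : Cfg₁ m)
    have h00 : ((y, v + s • ζ) : Cfg₁ m) + (0 : ℝ) • e = (y, v + s • ζ) := by simp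
    have hγd : HasDerivAt (fun τ : ℝ => L.legendreLoc φ (((y, v + s • ζ) : Cfg₁ m) + τ • e))
        (e.1, fun j => dq k (dv j (L.loc φ)) (y, v + s • ζ)) 0 := by
      have hΛ := L.hasFDerivAt_legendreLoc hφ hys
      rw [← h00] at hΛ
      refine (hΛ.comp_hasDerivAt (0 : ℝ) hline).congr_deriv ?_
      rw [h00]
      rfl
    have hγs : ContDiffAt ℝ ∞
        (fun τ : ℝ => L.legendreLoc φ (((y, v + s • ζ) : Cfg₁ m) + τ • e)) 0 := by
      refine ContDiffAt.comp (0 : ℝ) (g := L.legendreLoc φ) (f := fun τ : ℝ =>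
        ((y, v + s • ζ) : Cfg₁ m) + τ • e) ?_ ?_
      · rw [h00]; exact L.contDiffAt_legendreLoc hφ hys
      · exact contDiffAt_const.add (contDiffAt_id.smul contDiffAt_const)
    have hγN : ∀ᶠ τ in 𝓝 (0 : ℝ), L.legendreLoc φ (((y, v + s • ζ) : Cfg₁ m) + τ • e) ∈
        inCoord φ L.constraintSpace := by
      have h1 : Tendsto (fun τ : ℝ => (((y, v + s • ζ) : Cfg₁ m) + τ • e).1) (𝓝 0) (𝓝 y) := by
        have := hline.continuousAt.fst
        rwa [ContinuousAt, h00] at this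
      filter_upwards [h1.eventually (φ.open_target.mem_nhds hy)] with τ hτ
        using L.legendreLoc_mem hφ hτ
    have h := hL.dotL_deriv hφ (c := (y, v)) hy hζ hγs (by simp only [h00]; exact hfib s hs) hγN
    rw [hγd.deriv, dotL_apply] at h
    rw [hC]
    refine (Finset.sum_congr rfl fun j _ => mul_comm _ _).trans h
  have hder : ∀ s ∈ Icc (0 : ℝ) 1,
      HasDerivAt (fun s : ℝ => dq k (L.loc φ) (y, v + s • ζ) - s * C) 0 s := by
    intro s hs
    have hys : ((y, v + s • ζ) : Cfg₁ m).1 ∈ φ.target := hy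
    have hline : HasDerivAt (fun s : ℝ => ((y, v + s • ζ) : Cfg₁ m)) (0, ζ) s := by
      refine (hasDerivAt_const s y).prodMk ?_
      simpa using ((hasDerivAt_id s).smul_const ζ).const_add v
    have hd : HasFDerivAt (dq k (L.loc φ)) (fderiv ℝ (dq k (L.loc φ)) (y, v + s • ζ))
        (y, v + s • ζ) :=
      ((contDiffAt_fderiv_apply (L.contDiffAt_loc hφ hys) e).differentiableAt
        (by simp)).hasFDerivAt
    have h1 := (hd.comp_hasDerivAt s hline).sub ((hasDerivAt_id s).mul_const C)
    refine h1.congr_deriv ?_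
    have h0 : ((0, 0) : Cfg₁ m) = 0 := rfl
    have h2 : fderiv ℝ (dq k (L.loc φ)) (y, v + s • ζ) (0, ζ) =
        ∑ j, dq k (dv j (L.loc φ)) (y, v + s • ζ) * ζ j := by
      rw [fderiv_apply_eq_add_sum_dv, h0, map_zero, zero_add]
      refine Finset.sum_congr rfl fun j _ => ?_
      rw [mul_comm]
      congr 1
      exact fderiv_fderiv_comm (L.contDiffAt_loc hφ hys) _ _
    rw [h2, hslope s hs, one_mul, sub_self]
  have hconst := constant_of_has_deriv_right_zero (a := 0) (b := 1)
    (fun s hs => (hder s hs).continuousAt.continuousWithinAt)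
    (fun s hs => (hder s (Ico_subset_Icc_self hs)).hasDerivWithinAt) 1 (by simp)
  simp only [one_smul, zero_smul, add_zero, one_mul, zero_mul, sub_zero] at hconst
  linarith

/-- For a weakly associated Hamiltonian form, `∂_k 𝓗 = -∂_k 𝓛(t, q, w)` at `L̂(c)`, where `w` is the
value of the Hamiltonian map, provided that `w` has the same Legendre image as `c`. This comes from
differentiating the weak association identity; the derivatives of `w` cancel since
`π_i(t, q, w) = p_i`. -/
theorem HamiltonianForm.WeaklyAssociated.dq_loc
    {hπ : IsFibredManifold (m := m) π} {H : HamiltonianForm m π} {L : Lagrangian m π}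
    (hH : H.WeaklyAssociated hπ L) (hφ : IsFibredChart π φ) {c : Cfg₁ m} (hc : c.1 ∈ φ.target)
    {w : Fin m → ℝ} (hw : ∀ i, dv i (H.loc φ) (L.legendreLoc φ c) = w i)
    (hleg : L.legendreLoc φ (c.1, w) = L.legendreLoc φ c) (k : Fin m) :
    dq k (H.loc φ) (L.legendreLoc φ c) = - dq k (L.loc φ) (c.1, w) := by
  set e : Cfg₁ m := ((0, Pi.single k 1), 0) with he
  set p := L.legendreLoc φ c with hp
  have hΛ := L.hasFDerivAt_legendreLoc hφ hc
  have hpt : p.1 ∈ φ.target := hc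
  let W : Cfg₁ m → Fin m → ℝ := fun c i => dv i (H.loc φ) (L.legendreLoc φ c)
  have hWc : W c = w := funext hw
  have hW : ∀ i, DifferentiableAt ℝ (fun c => W c i) c := fun i =>
    DifferentiableAt.comp (g := dv i (H.loc φ)) c
      ((contDiffAt_fderiv_apply (H.contDiffAt_loc hφ hpt) _).differentiableAt
      (by simp)) hΛ.differentiableAt
  have hWd : HasFDerivAt W (ContinuousLinearMap.pi fun i => fderiv ℝ (fun c => W c i) c) c :=
    hasFDerivAt_pi.2 fun i => (hW i).hasFDerivAt
  have hπd : ∀ i, HasFDerivAt (dv i (L.loc φ)) (fderiv ℝ (dv i (L.loc φ)) c) c := fun i =>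
    ((L.contDiffAt_dv hφ hc i).differentiableAt (by simp)).hasFDerivAt
  have hHd : HasFDerivAt (H.loc φ) (fderiv ℝ (H.loc φ) p) (L.legendreLoc φ c) :=
    ((H.contDiffAt_loc hφ hpt).differentiableAt (by simp)).hasFDerivAt
  have hLd : HasFDerivAt (L.loc φ) (fderiv ℝ (L.loc φ) (c.1, w)) (c.1, W c) := by
    rw [hWc]
    exact ((L.contDiffAt_loc hφ (c := (c.1, w)) hc).differentiableAt (by simp)).hasFDerivAt
  have hsum : HasFDerivAt (fun c => ∑ i, W c i * dv i (L.loc φ) c) _ c :=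
    HasFDerivAt.fun_sum fun i _ => (hW i).hasFDerivAt.mul (hπd i)
  have hlhs := hsum.fun_sub (hHd.comp c hΛ)
  have hrhs := hLd.comp c (hasFDerivAt_fst.prodMk hWd)
  have hev : (fun c => ∑ i, W c i * dv i (L.loc φ) c - H.loc φ (L.legendreLoc φ c)) =ᶠ[𝓝 c]
      fun c => L.loc φ (c.1, W c) := by
    filter_upwards [(φ.open_target.prod isOpen_univ).mem_nhds
      (⟨hc, mem_univ _⟩ : c ∈ φ.target ×ˢ (univ : Set (Fin m → ℝ)))] with c' hc'
      using hH.loc hφ hc'.1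
  have h := congrArg (fun T => T e) ((hlhs.fderiv.symm.trans hev.fderiv_eq).trans hrhs.fderiv)
  have h1 : ∑ i, (W c i * fderiv ℝ (dv i (L.loc φ)) c e +
      dv i (L.loc φ) c * fderiv ℝ (fun c => W c i) c e) -
      fderiv ℝ (H.loc φ) p (e.1, fun i => fderiv ℝ (dv i (L.loc φ)) c e) =
      fderiv ℝ (L.loc φ) (c.1, w) (e.1, fun i => fderiv ℝ (fun c => W c i) c e) := by
    rw [sub_apply, sum_apply] at h
    exact h
  rw [fderiv_apply_eq_add_sum_dv (H.loc φ), fderiv_apply_eq_add_sum_dv (L.loc φ)] at h1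
  have hdv : ∀ i, dv i (L.loc φ) (c.1, w) = dv i (L.loc φ) c := fun i =>
    congrFun (congrArg Prod.snd hleg) i
  have hWi : ∀ i, W c i = dv i (H.loc φ) p := fun i => rfl
  simp only [hdv, hWi, Finset.sum_add_distrib] at h1
  have h2 : ∑ i, dv i (H.loc φ) p * fderiv ℝ (dv i (L.loc φ)) c e =
      ∑ i, fderiv ℝ (dv i (L.loc φ)) c e * dv i (H.loc φ) p :=
    Finset.sum_congr rfl fun i _ => mul_comm _ _
  have h3 : ∑ i, dv i (L.loc φ) c * fderiv ℝ (fun c => W c i) c e =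
      ∑ i, fderiv ℝ (fun c => W c i) c e * dv i (L.loc φ) c :=
    Finset.sum_congr rfl fun i _ => mul_comm _ _
  show fderiv ℝ (H.loc φ) p (e.1, 0) = - fderiv ℝ (L.loc φ) (c.1, w) (e.1, 0)
  linarith

/-! ### Sections in coordinates and the Hamilton equation -/

theorem IsJetSectionOn.contMDiffOn_pt [IsManifold 𝓘(ℝ, Cfg m) ∞ Q] {U : Set ℝ}
    {sbar : ℝ → Jet m π} (hs : IsJetSectionOn U sbar) :
    ContMDiffOn 𝓘(ℝ, ℝ) 𝓘(ℝ, Cfg m) ∞ (fun t => (sbar t).pt) U :=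
  (Bundle.contMDiff_proj (TangentSpace 𝓘(ℝ, Cfg m) (M := Q))).comp_contMDiffOn hs.1

theorem IsJetSectionOn.contDiffOn_jetCoord [IsManifold 𝓘(ℝ, Cfg m) ∞ Q] {U : Set ℝ}
    {sbar : ℝ → Jet m π} (hs : IsJetSectionOn U sbar) (hφ : IsFibredChart π φ) :
    ContDiffOn ℝ ∞ (fun t => jetCoord φ (sbar t)) {t ∈ U | (sbar t).pt ∈ φ.source} := by
  have : IsManifold 𝓘(ℝ, Cfg m) 1 Q := .of_le (n := ∞) (by simp)
  have hφs := contMDiffOn_of_mem_maximalAtlas hφ.1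
  rw [← contMDiffOn_iff_contDiffOn]
  have h1 : ContMDiffOn 𝓘(ℝ, ℝ) 𝓘(ℝ, Cfg m) ∞ (fun t => φ (sbar t).pt)
      {t ∈ U | (sbar t).pt ∈ φ.source} :=
    hφs.comp (hs.contMDiffOn_pt.mono fun t ht => ht.1) fun t ht => ht.2
  have h2 := hφs.contMDiffOn_tangentMapWithin (m := ∞) (by simp) φ.open_source.uniqueMDiffOn
  have h3 := (contMDiff_snd_tangentBundle_modelSpace (Cfg m) 𝓘(ℝ, Cfg m)
    (n := ∞)).comp_contMDiffOn (h2.comp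
      (hs.1.mono (fun t ht => ht.1 : {t ∈ U | (sbar t).pt ∈ φ.source} ⊆ U)) fun t ht => ht.2)
  have h4 : ContMDiffOn 𝓘(ℝ, ℝ) 𝓘(ℝ, Cfg m) ∞ (fun t => chartComp φ (sbar t).pt (sbar t).vel)
      {t ∈ U | (sbar t).pt ∈ φ.source} := by
    refine h3.congr fun t ht => ?_
    exact congrArg (fun A : Cfg m →L[ℝ] Cfg m => A (sbar t).vel)
      (mfderivWithin_of_isOpen φ.open_source ht.2).symm
  rw [contMDiffOn_iff_contDiffOn] at *
  exact h1.prodMk (contDiff_snd.comp_contDiffOn h4)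

theorem hasDerivAt_chart_comp (hφ : IsFibredChart π φ)
    {s : ℝ → Q} {t : ℝ} (hs : MDifferentiableAt 𝓘(ℝ, ℝ) 𝓘(ℝ, Cfg m) s t)
    (ht : s t ∈ φ.source) :
    HasDerivAt (fun τ => φ (s τ)) (chartComp φ (s t) (jetProlongation m s t).snd) t := by
  have h1 := ((hφ.mdifferentiable.mdifferentiableAt ht).hasMFDerivAt.comp t hs.hasMFDerivAt)
  have h2 : HasFDerivAt (fun τ => φ (s τ)) ((chartComp φ (s t)).comp
      (mfderiv 𝓘(ℝ, ℝ) 𝓘(ℝ, Cfg m) s t : ℝ →L[ℝ] Cfg m)) t := hasMFDerivAt_iff_hasFDerivAt.1 h1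
  exact h2.hasDerivAt

end TimeMechanics

theorem theorem3p4 {m : ℕ} {Q : Type*} [TopologicalSpace Q]
    [ChartedSpace (TimeMechanics.Cfg m) Q] [IsManifold 𝓘(ℝ, TimeMechanics.Cfg m) ∞ Q]
    {π : Q → ℝ} (hπ : TimeMechanics.IsFibredManifold (m := m) π)
    (L : TimeMechanics.Lagrangian m π) (hL : L.IsAlmostRegular)
    {U : Set ℝ} (hU : IsOpen U)
    (sbar : ℝ → TimeMechanics.Jet m π) (hsbar : TimeMechanics.IsJetSectionOn U sbar)
    (hC : L.SolvesCartan U sbar)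
    (H : TimeMechanics.HamiltonianForm m π) (hH : H.WeaklyAssociated hπ L)
    (hrel : ∀ t ∈ U, (H.hamiltonianMap hπ (L.legendre (sbar t))).1 =
      TimeMechanics.jetProlongation m (fun τ => (sbar τ).pt) t) :
    TimeMechanics.IsPhaseSectionOn U (fun t => L.legendre (sbar t)) ∧
      H.SolvesHamilton U (fun t => L.legendre (sbar t)) := by
  open TimeMechanics in
  have hmom : ∀ φ : OpenPartialHomeomorph Q (Cfg m), IsFibredChart π φ →
      ContDiffOn ℝ ∞ (fun t => momCoord φ (L.legendre (sbar t)))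
        {t ∈ U | (sbar t).pt ∈ φ.source} := by
    intro φ hφ t ht
    have h1 := (L.contDiffAt_legendreLoc hφ (c := jetCoord φ (sbar t))
      (φ.map_source ht.2)).comp_contDiffWithinAt t (hsbar.contDiffOn_jetCoord hφ t ht)
    exact h1.congr (fun τ hτ => L.momCoord_legendre hφ hτ.2) (L.momCoord_legendre hφ ht.2)
  refine ⟨⟨hsbar.contMDiffOn_pt, hmom, hsbar.2⟩, fun φ hφ t ht hts k => ?_⟩
  replace hts : (sbar t).pt ∈ φ.source := hts
  have hsd : MDifferentiableAt 𝓘(ℝ, ℝ) 𝓘(ℝ, Cfg m) (fun τ => (sbar τ).pt) t :=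
    (hsbar.contMDiffOn_pt.contMDiffAt (hU.mem_nhds ht)).mdifferentiableAt (by simp)
  -- The jet of the projected section, in every chart, is `z`.
  set z := H.hamiltonianMap hπ (L.legendre (sbar t)) with hz
  have hvel : ∀ ψ : OpenPartialHomeomorph Q (Cfg m), IsFibredChart π ψ → (sbar t).pt ∈ ψ.source →
      HasDerivAt (fun τ => ψ (sbar τ).pt) (chartComp ψ (sbar t).pt z.vel) t := by
    intro ψ hψ hψs
    have h1 := hasDerivAt_chart_comp hψ hsd hψs
    rw [← hrel t ht] at h1
    exact h1
  have hder : ∀ ψ : OpenPartialHomeomorph Q (Cfg m), IsFibredChart π ψ → (sbar t).pt ∈ ψ.source →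
      ∀ j, HasDerivAt (fun τ => (jetCoord ψ (sbar τ)).1.2 j) ((jetCoord ψ z).2 j) t := by
    intro ψ hψ hψs j
    exact hasDerivAt_pi.1 (hvel ψ hψ hψs).snd j
  have hzv : z.vel - (sbar t).vel ∈ Vert (m := m) π (sbar t).pt := by
    have h1 : dt π (sbar t).pt z.vel = 1 := z.dt_vel
    show dt π (sbar t).pt _ = 0
    rw [map_sub, h1, (sbar t).dt_vel, sub_self]
  -- The vertical vector `q^j_(t) - q^j_t`, which the first Cartan equation puts into the kernel of
  -- the fibre Hessian.
  set u : Vert (m := m) π (sbar t).pt := ⟨_, hzv⟩ with hu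
  have hζ : ∀ ψ : OpenPartialHomeomorph Q (Cfg m), (chartComp ψ (sbar t).pt (u : Cfg m)).2 =
      (jetCoord ψ z).2 - (jetCoord ψ (sbar t)).2 := by
    intro ψ
    show (chartComp ψ (sbar t).pt (z.vel - (sbar t).vel)).2 = _
    rw [map_sub]
    rfl
  have hker : ∀ ψ : OpenPartialHomeomorph Q (Cfg m), IsFibredChart π ψ → (sbar t).pt ∈ ψ.source →
      ∀ i, ∑ j, dv i (dv j (L.loc ψ)) (jetCoord ψ (sbar t)) *
        (chartComp ψ (sbar t).pt (u : Cfg m)).2 j = 0 := by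
    intro ψ hψ hψs i
    have h1 := (hC ψ hψ t ht hψs i).1
    simp only [(hder ψ hψ hψs _).deriv] at h1
    rw [hζ]
    exact h1
  have hfib := fun s (hs : s ∈ Icc (0 : ℝ) 1) => hL.legendre_addVert_smul hker hs
  set y := φ (sbar t).pt with hy
  set v := (jetCoord φ (sbar t)).2 with hv
  set w := (jetCoord φ z).2 with hw
  have hyt : y ∈ φ.target := φ.map_source hts
  have hζφ : (chartComp φ (sbar t).pt (u : Cfg m)).2 = w - v := hζ φ
  have hkerφ : ∀ i, ∑ j, dv i (dv j (L.loc φ)) (y, v) * (w - v) j = 0 := by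
    intro i
    rw [← hζφ]
    exact hker φ hφ hts i
  have hfibφ : ∀ s ∈ Icc (0 : ℝ) 1,
      L.legendreLoc φ (y, v + s • (w - v)) = L.legendreLoc φ (y, v) := by
    intro s hs
    have h1 := congrArg (momCoord φ) (hfib s hs)
    rw [L.momCoord_legendre hφ hts, L.momCoord_legendre hφ (z := (sbar t).addVert (s • u)) hts,
      jetCoord_addVert, Submodule.coe_smul, map_smul, Prod.smul_snd, hζφ] at h1
    have h2 : jetCoord φ (sbar t) + (0, s • (w - v)) = (y, v + s • (w - v)) :=
      Prod.ext (add_zero _) rfl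
    rwa [h2] at h1
  have hp : momCoord φ (L.legendre (sbar t)) = L.legendreLoc φ (y, v) :=
    L.momCoord_legendre hφ hts
  have hdvH : ∀ i, dv i (H.loc φ) (L.legendreLoc φ (y, v)) = w i := by
    intro i
    rw [← hp, hw, hz, H.jetCoord_hamiltonianMap hπ hφ (p := L.legendre (sbar t)) hts]
  have hdqH := hH.dq_loc hφ (c := (y, v)) hyt hdvH (by simpa using hfibφ 1 (by simp)) k
  have hdqL := hL.submersion.dq_loc_add hφ hyt hkerφ hfibφ k
  rw [add_sub_cancel] at hdqL
  have hcart := (hC φ hφ t ht hts k).2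
  simp only [(hder φ hφ hts _).deriv] at hcart
  have hopen : {τ ∈ U | (sbar τ).pt ∈ φ.source} ∈ 𝓝 t := by
    filter_upwards [hU.mem_nhds ht, hsd.continuousAt.eventually (φ.open_source.mem_nhds hts)]
      with τ h1 h2 using ⟨h1, h2⟩
  have hmd : DifferentiableAt ℝ (fun τ => (momCoord φ (L.legendre (sbar τ))).2 k) t :=
    differentiableAt_pi.1 (((hmom φ hφ).contDiffAt hopen).differentiableAt (by simp)).snd k
  have hmeq : (fun τ => (momCoord φ (L.legendre (sbar τ))).2 k) =ᶠ[𝓝 t]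
      fun τ => dv k (L.loc φ) (jetCoord φ (sbar τ)) := by
    filter_upwards [hopen] with τ hτ
    rw [L.momCoord_legendre hφ hτ.2]
    rfl
  constructor
  · rw [hp, hdvH]
    exact hder φ hφ hts k
  · have h1 := hmd.hasDerivAt
    rw [hmeq.deriv_eq] at h1
    rw [hp, hdqH, neg_neg, hdqL]
    refine h1.congr_deriv ?_
    have h2 : jetCoord φ (sbar t) = (y, v) := rfl
    simp only [h2, Pi.sub_apply] at hcart ⊢
    linarith
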